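/- **Setting.** Fix $m,p$, covariates $\mathbf x_{ij}\in\mathbb R^p$ ($i\ge1$, $1\le j\le m$), $\mathbf X_i=(\mathbf x_{i1},\dots,\mathbf x_{im})^T$, an open set $\mathcal B\subseteq\mathbb R^p$ and a true parameter $\beta_0\in\mathcal B$. Let $\mu:\mathbb R\to\mathbb R$ be $C^1$ with $\dot\mu>0$, and put $\theta_{ij}(\beta)=\mathbf x_{ij}^T\beta$, $\sigma_{ij}^2(\beta)=\dot\mu(\theta_{ij}(\beta))$, $\mathbf A_i(\beta)=\mathrm{diag}(\sigma_{i1}^2(\beta),\dots,\sigma_{im}^2(\beta))$; the argument $\beta_0$ is omitted. Let $\mathbf y_i=(y_{i1},\dots,y_{im})^T$, $i\ge1$, be square integrable random vectors on a probability space with $E(y_{ij})=\mu(\theta_{ij})$ and $\mathrm{Var}(y_{ij})=\sigma_{ij}^2$, and let $\varepsilon_i(\beta)$ have the components $y_{ij}-\mu(\theta_{ij}(\beta))$. Assume $E(\varepsilon_i\mid\mathcal F_{i-1})=0$ for all $i\ge1$, where $\mathcal F_i=\sigma(\varepsilon_1,\dots,\varepsilon_i)$. Let $\bar{\mathbf R}_i$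 be the correlation matrix of $\mathbf y_i$, $\bar{\mathbf R}_n^{\mathrm{av}}=\frac1n\sum_{i\le n}\bar{\mathbf R}_i$ the average true correlation matrix, and $\mathbf y_i^*=\mathbf A_i^{-1/2}\varepsilon_i$. Put $\mathbf g_n(\beta)=\sum_{i\le n}\mathbf X_i^T\varepsilon_i(\beta)$, $\mathbf H_n=\sum_{i\le n}\mathbf X_i^T\mathbf A_i\mathbf X_i$, $\gamma_n=\max_{i\le n,\,j\le m}\mathbf x_{ij}^T\mathbf H_n^{-1}\mathbf x_{ij}$ and $B_n(r)=\{\beta\in\mathcal B:\|\mathbf H_n^{1/2}(\beta-\beta_0)\|\le m^{1/2}r\}$. **Conditions.** - $(\mathrm C)^{\mathrm{indep}}$: $\mu$ is three times differentiable; for every $r>0$ the quantities $\sup_{\beta\in B_n(r)}\max_{i\le n,\,j\le m}|\mu^{(l)}(\theta_{ij}(\beta))/\dot\mu(\theta_{ij}(\beta))|$, $l=2,3$, are bounded in $n$; $\lambda_{\min}(\mathbf H_n)\to\infty$; and $n^{1/2}\gamma_n\to0$. - (C1): $\sup_iE\|\mathbf y_i^*\|^{2+\delta}<\infty$ for some $\delta\in(0,2]$.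 - (C2): $\frac1n\sum_{i\le n}\{E(\mathbf y_i^*\mathbf y_i^{*T}\mid\mathcal F_{i-1})-\bar{\mathbf R}_i\}\to0$ in probability. **Estimators.** Let $(b_n)$ be random vectors in $\mathcal B$ with $P(\mathbf g_n(b_n)=0)\to1$ and $b_n\to\beta_0$ in probability (working-independence estimators). For numbers $r_n$ let $\tilde\beta_n$, the preliminary estimator localized at radius $r_n$, be $b_n$ if $b_n\in B_n(r_n)$ and $\beta_0$ otherwise, and let $$\tilde{\mathcal R}_n=\frac1n\sum_{i\le n}\mathbf A_i(\tilde\beta_n)^{-1/2}\varepsilon_i(\tilde\beta_n)\varepsilon_i(\tilde\beta_n)^T\mathbf A_i(\tilde\beta_n)^{-1/2},\qquad \mathbf R_n=E(\tilde{\mathcal R}_n).$$ **Theorem 1.** Assume $(\mathrm C)^{\mathrm{indep}}$, (C1) and (C2). 1. For every $\epsilon>0$ there are $r>0$ and $N$ with $P(b_n\in B_n(r))\ge1-\epsilon$ for all $n\ge N$. 2. For every constant radius $r_n=r>0$, the entries of $\tilde{\mathcal R}_n$ are integrable, so that $\mathbf R_n$ exists, and, elementwise, $\tilde{\mathcal R}_n-\mathbf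 R_n\to0$ and $\tilde{\mathcal R}_n-\bar{\mathbf R}_n^{\mathrm{av}}\to0$ in $L^1$. If the convergence in (C2) is almost sure, then both convergences also hold almost surely. 3. There are radii $r_n\to\infty$ for which the localized estimators $\tilde\beta_n$ again satisfy $P(\mathbf g_n(\tilde\beta_n)=0)\to1$ and $\tilde\beta_n\to\beta_0$ in probability, and for which all the conclusions of part 2 hold. -/

import Mathlib

open MeasureTheory ProbabilityTheory Filter Topology Matrix
open scoped ENNReal MatrixOrder Matrix.Norms.L2Operator

noncomputable section

namespace LongitudinalGEE

/-! Subjects are indexed by `i : ℕ` (from `0`), so that the first `n` subjects are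
`i ∈ Finset.range n`; repeated measurements are indexed by `j : Fin m`. -/

/-- Linear predictor `θ_ij(β) = x_ijᵀ β`. -/
def theta {m p : ℕ} (x : ℕ → Fin m → EuclideanSpace ℝ (Fin p)) (i : ℕ) (j : Fin m)
    (β : EuclideanSpace ℝ (Fin p)) : ℝ :=
  x i j ⬝ᵥ β

/-- The design matrix `X_i`, whose rows are the covariate vectors `x_ij`. -/
def designMatrix {m p : ℕ} (x : ℕ → Fin m → EuclideanSpace ℝ (Fin p)) (i : ℕ) :
    Matrix (Fin m) (Fin p) ℝ :=
  Matrix.of fun j k => x i j k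

/-- Marginal variances `σ_ij²(β) = μ'(θ_ij(β))`. -/
def sigmaSq {m p : ℕ} (μ : ℝ → ℝ) (x : ℕ → Fin m → EuclideanSpace ℝ (Fin p)) (i : ℕ)
    (j : Fin m) (β : EuclideanSpace ℝ (Fin p)) : ℝ :=
  deriv μ (theta x i j β)

/-- `A_i(β) = diag(σ_i1²(β), …, σ_im²(β))`. -/
def varMatrix {m p : ℕ} (μ : ℝ → ℝ) (x : ℕ → Fin m → EuclideanSpace ℝ (Fin p)) (i : ℕ)
    (β : EuclideanSpace ℝ (Fin p)) : Matrix (Fin m) (Fin m) ℝ :=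
  Matrix.diagonal fun j => sigmaSq μ x i j β

/-- `A_i(β)^{-1/2}`. -/
def varMatrixInvSqrt {m p : ℕ} (μ : ℝ → ℝ) (x : ℕ → Fin m → EuclideanSpace ℝ (Fin p)) (i : ℕ)
    (β : EuclideanSpace ℝ (Fin p)) : Matrix (Fin m) (Fin m) ℝ :=
  Matrix.diagonal fun j => (√(sigmaSq μ x i j β))⁻¹

/-- Residuals `ε_ij(β) = y_ij - μ(θ_ij(β))`. -/
def resid {m p : ℕ} {Ω : Type*} (μ : ℝ → ℝ) (x : ℕ → Fin m → EuclideanSpace ℝ (Fin p))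
    (y : ℕ → Ω → Fin m → ℝ) (i : ℕ) (β : EuclideanSpace ℝ (Fin p)) (ω : Ω) : Fin m → ℝ :=
  fun j => y i ω j - μ (theta x i j β)

/-- The `σ`-field generated by the residuals (at `β₀`) of the subjects preceding subject `i`. -/
@[reducible] def past {m p : ℕ} {Ω : Type*} (μ : ℝ → ℝ) (x : ℕ → Fin m → EuclideanSpace ℝ (Fin p))
    (β₀ : EuclideanSpace ℝ (Fin p)) (y : ℕ → Ω → Fin m → ℝ) (i : ℕ) : MeasurableSpace Ω :=
  ⨆ k : Fin i, MeasurableSpace.comap (fun ω => resid μ x y k β₀ ω) inferInstance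

/-- Standing assumptions: a `C¹` link function with positive derivative, a true parameter in the
open parameter set, square integrable responses with the marginal means and variances prescribed
by the link, and residuals which form a martingale difference sequence. -/
structure IsModel {m p : ℕ} {Ω : Type*} [MeasurableSpace Ω] (P : Measure Ω) (μ : ℝ → ℝ)
    (x : ℕ → Fin m → EuclideanSpace ℝ (Fin p)) (B : Set (EuclideanSpace ℝ (Fin p)))
    (β₀ : EuclideanSpace ℝ (Fin p)) (y : ℕ → Ω → Fin m → ℝ) : Prop where
  link_contDiff : ContDiff ℝ 1 μ
  link_deriv_pos : ∀ t, 0 < deriv μ t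
  isOpen_param : IsOpen B
  true_mem : β₀ ∈ B
  measurable_obs : ∀ i, Measurable (y i)
  sq_integrable : ∀ i j, MemLp (fun ω => y i ω j) 2 P
  mean_eq : ∀ i j, ∫ ω, y i ω j ∂P = μ (theta x i j β₀)
  variance_eq : ∀ i j, variance (fun ω => y i ω j) P = sigmaSq μ x i j β₀
  martingale_diff : ∀ i j, P[fun ω => resid μ x y i β₀ ω j | past μ x β₀ y i] =ᵐ[P] 0

/-- The working-independence estimating function `g_n(β) = ∑_{i ≤ n} X_iᵀ ε_i(β)`. -/
def gIndep {m p : ℕ} {Ω : Type*} (μ : ℝ → ℝ) (x : ℕ → Fin m → EuclideanSpace ℝ (Fin p))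
    (y : ℕ → Ω → Fin m → ℝ) (n : ℕ) (β : EuclideanSpace ℝ (Fin p)) (ω : Ω) : Fin p → ℝ :=
  ∑ i ∈ Finset.range n, (designMatrix x i)ᵀ *ᵥ resid μ x y i β ω

/-- `H_n = ∑_{i ≤ n} X_iᵀ A_i X_i` (with `A_i` at `β₀`). -/
def HIndep {m p : ℕ} (μ : ℝ → ℝ) (x : ℕ → Fin m → EuclideanSpace ℝ (Fin p))
    (β₀ : EuclideanSpace ℝ (Fin p)) (n : ℕ) : Matrix (Fin p) (Fin p) ℝ :=
  ∑ i ∈ Finset.range n, (designMatrix x i)ᵀ * varMatrix μ x i β₀ * designMatrix x i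

/-- Smallest (real) eigenvalue of a symmetric matrix. -/
def lambdaMin {p : ℕ} (M : Matrix (Fin p) (Fin p) ℝ) : ℝ :=
  sInf (spectrum ℝ M)

/-- `γ_n = max_{i ≤ n, j ≤ m} x_ijᵀ H_n⁻¹ x_ij`. -/
def gammaIndep {m p : ℕ} (μ : ℝ → ℝ) (x : ℕ → Fin m → EuclideanSpace ℝ (Fin p))
    (β₀ : EuclideanSpace ℝ (Fin p)) (n : ℕ) : ℝ :=
  ⨆ q : Fin n × Fin m, x q.1 q.2 ⬝ᵥ ((HIndep μ x β₀ n)⁻¹ *ᵥ x q.1 q.2)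

/-- `k_n^{[l]}(β) = max_{i ≤ n, j ≤ m} |μ^{(l)}(θ_ij(β)) / μ'(θ_ij(β))|`. -/
def kMax {m p : ℕ} (μ : ℝ → ℝ) (x : ℕ → Fin m → EuclideanSpace ℝ (Fin p)) (l n : ℕ)
    (β : EuclideanSpace ℝ (Fin p)) : ℝ :=
  ⨆ q : Fin n × Fin m,
    |iteratedDeriv l μ (theta x q.1 q.2 β) / deriv μ (theta x q.1 q.2 β)|

/-- The neighbourhood `B_n(r) = {β ∈ B : ‖H_n^{1/2} (β - β₀)‖ ≤ m^{1/2} r}`. -/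
def ballIndep {m p : ℕ} (μ : ℝ → ℝ) (x : ℕ → Fin m → EuclideanSpace ℝ (Fin p))
    (B : Set (EuclideanSpace ℝ (Fin p))) (β₀ : EuclideanSpace ℝ (Fin p)) (n : ℕ) (r : ℝ) :
    Set (EuclideanSpace ℝ (Fin p)) :=
  {β | β ∈ B ∧ ‖WithLp.toLp 2 (CFC.sqrt (HIndep μ x β₀ n) *ᵥ (β - β₀ : EuclideanSpace ℝ (Fin p)))‖
    ≤ √(m : ℝ) * r}

/-- The set of conditions (C)^indep: the higher derivatives of the link are dominated by the first
one on the neighbourhoods `B_n(r)`, uniformly in `n`; `λ_min(H_n) → ∞`; `n^{1/2} γ_n → 0`. -/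
structure CondIndep {m p : ℕ} (μ : ℝ → ℝ) (x : ℕ → Fin m → EuclideanSpace ℝ (Fin p))
    (B : Set (EuclideanSpace ℝ (Fin p))) (β₀ : EuclideanSpace ℝ (Fin p)) : Prop where
  differentiable_two : Differentiable ℝ (iteratedDeriv 1 μ)
  differentiable_three : Differentiable ℝ (iteratedDeriv 2 μ)
  bounded : ∀ r : ℝ, 0 < r → ∃ K : ℝ, ∀ n : ℕ, ∀ β ∈ ballIndep μ x B β₀ n r,
    kMax μ x 2 n β ≤ K ∧ kMax μ x 3 n β ≤ K
  eigen : Tendsto (fun n => lambdaMin (HIndep μ x β₀ n)) atTop atTop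
  leverage : Tendsto (fun n : ℕ => √(n : ℝ) * gammaIndep μ x β₀ n) atTop (𝓝 0)

/-- Normalized residuals `y_i^* = A_i^{-1/2} ε_i` (at `β₀`). -/
def ystar {m p : ℕ} {Ω : Type*} (μ : ℝ → ℝ) (x : ℕ → Fin m → EuclideanSpace ℝ (Fin p))
    (β₀ : EuclideanSpace ℝ (Fin p)) (y : ℕ → Ω → Fin m → ℝ) (i : ℕ) (ω : Ω) : Fin m → ℝ :=
  varMatrixInvSqrt μ x i β₀ *ᵥ resid μ x y i β₀ ω

/-- The true correlation matrix of `y_i`. -/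
def trueCorr {m : ℕ} {Ω : Type*} [MeasurableSpace Ω] (P : Measure Ω)
    (y : ℕ → Ω → Fin m → ℝ) (i : ℕ) : Matrix (Fin m) (Fin m) ℝ :=
  Matrix.of fun j k => covariance (fun ω => y i ω j) (fun ω => y i ω k) P /
    (√(variance (fun ω => y i ω j) P) * √(variance (fun ω => y i ω k) P))

/-- The average `(1/n) ∑_{i ≤ n}` of the true correlation matrices. -/
def avgTrueCorr {m : ℕ} {Ω : Type*} [MeasurableSpace Ω] (P : Measure Ω)
    (y : ℕ → Ω → Fin m → ℝ) (n : ℕ) : Matrix (Fin m) (Fin m) ℝ :=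
  (1 / (n : ℝ)) • ∑ i ∈ Finset.range n, trueCorr P y i

/-- Condition (C1): the normalized residuals have bounded moments of some order `2 + δ`. -/
def CondC1 {m p : ℕ} {Ω : Type*} [MeasurableSpace Ω] (P : Measure Ω) (μ : ℝ → ℝ)
    (x : ℕ → Fin m → EuclideanSpace ℝ (Fin p)) (β₀ : EuclideanSpace ℝ (Fin p))
    (y : ℕ → Ω → Fin m → ℝ) : Prop :=
  ∃ δ : ℝ, 0 < δ ∧ δ ≤ 2 ∧
    ⨆ i : ℕ, ∫⁻ ω, ‖WithLp.toLp 2 (ystar μ x β₀ y i ω)‖ₑ ^ (2 + δ) ∂P < ∞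

/-- `V_i = E(y_i^* y_i^{*T} | F_{i-1}) - R̄_i`. -/
def condCovDev {m p : ℕ} {Ω : Type*} [MeasurableSpace Ω] (P : Measure Ω) (μ : ℝ → ℝ)
    (x : ℕ → Fin m → EuclideanSpace ℝ (Fin p)) (β₀ : EuclideanSpace ℝ (Fin p))
    (y : ℕ → Ω → Fin m → ℝ) (i : ℕ) (ω : Ω) : Matrix (Fin m) (Fin m) ℝ :=
  Matrix.of fun j k =>
    (P[fun ω' => ystar μ x β₀ y i ω' j * ystar μ x β₀ y i ω' k | past μ x β₀ y i]) ω
      - trueCorr P y i j k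

/-- The average `(1/n) ∑_{i ≤ n} V_i`. -/
def avgCondCovDev {m p : ℕ} {Ω : Type*} [MeasurableSpace Ω] (P : Measure Ω) (μ : ℝ → ℝ)
    (x : ℕ → Fin m → EuclideanSpace ℝ (Fin p)) (β₀ : EuclideanSpace ℝ (Fin p))
    (y : ℕ → Ω → Fin m → ℝ) (n : ℕ) (ω : Ω) : Matrix (Fin m) (Fin m) ℝ :=
  (1 / (n : ℝ)) • ∑ i ∈ Finset.range n, condCovDev P μ x β₀ y i ω

/-- Condition (C2): `(1/n) ∑_{i ≤ n} V_i → 0` in probability. -/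
def CondC2 {m p : ℕ} {Ω : Type*} [MeasurableSpace Ω] (P : Measure Ω) (μ : ℝ → ℝ)
    (x : ℕ → Fin m → EuclideanSpace ℝ (Fin p)) (β₀ : EuclideanSpace ℝ (Fin p))
    (y : ℕ → Ω → Fin m → ℝ) : Prop :=
  ∀ j k, TendstoInMeasure P (fun n ω => avgCondCovDev P μ x β₀ y n ω j k) atTop (fun _ => 0)

/-- Condition (C2) with almost sure convergence. -/
def CondC2AS {m p : ℕ} {Ω : Type*} [MeasurableSpace Ω] (P : Measure Ω) (μ : ℝ → ℝ)
    (x : ℕ → Fin m → EuclideanSpace ℝ (Fin p)) (β₀ : EuclideanSpace ℝ (Fin p))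
    (y : ℕ → Ω → Fin m → ℝ) : Prop :=
  ∀ j k, ∀ᵐ ω ∂P, Tendsto (fun n => avgCondCovDev P μ x β₀ y n ω j k) atTop (𝓝 0)

/-- `b_n` are random vectors in the parameter set which solve the working-independence estimating
equation with probability tending to one and converge in probability to `β₀`. -/
structure IsPrelim {m p : ℕ} {Ω : Type*} [MeasurableSpace Ω] (P : Measure Ω) (μ : ℝ → ℝ)
    (x : ℕ → Fin m → EuclideanSpace ℝ (Fin p)) (B : Set (EuclideanSpace ℝ (Fin p)))
    (β₀ : EuclideanSpace ℝ (Fin p)) (y : ℕ → Ω → Fin m → ℝ)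
    (b : ℕ → Ω → EuclideanSpace ℝ (Fin p)) : Prop where
  measurable : ∀ n, Measurable (b n)
  mem : ∀ n ω, b n ω ∈ B
  root : Tendsto (fun n => P {ω | gIndep μ x y n (b n ω) ω = 0}) atTop (𝓝 1)
  consistent : TendstoInMeasure P b atTop (fun _ => β₀)

open Classical in
/-- The estimator which equals `b_n` if `b_n` lies in `B_n(r_n)`, and `β₀` otherwise. -/
def localize {m p : ℕ} {Ω : Type*} (μ : ℝ → ℝ) (x : ℕ → Fin m → EuclideanSpace ℝ (Fin p))
    (B : Set (EuclideanSpace ℝ (Fin p))) (β₀ : EuclideanSpace ℝ (Fin p))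
    (b : ℕ → Ω → EuclideanSpace ℝ (Fin p)) (r : ℕ → ℝ) (n : ℕ) (ω : Ω) :
    EuclideanSpace ℝ (Fin p) :=
  if b n ω ∈ ballIndep μ x B β₀ n (r n) then b n ω else β₀

/-- The estimated average correlation matrix
`R̃_n = (1/n) ∑_{i ≤ n} A_i(β̃_n)^{-1/2} ε_i(β̃_n) ε_i(β̃_n)ᵀ A_i(β̃_n)^{-1/2}`. -/
def estCorr {m p : ℕ} {Ω : Type*} (μ : ℝ → ℝ) (x : ℕ → Fin m → EuclideanSpace ℝ (Fin p))
    (y : ℕ → Ω → Fin m → ℝ) (βt : ℕ → Ω → EuclideanSpace ℝ (Fin p)) (n : ℕ) (ω : Ω) :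
    Matrix (Fin m) (Fin m) ℝ :=
  (1 / (n : ℝ)) • ∑ i ∈ Finset.range n,
    varMatrixInvSqrt μ x i (βt n ω) *
      Matrix.vecMulVec (resid μ x y i (βt n ω) ω) (resid μ x y i (βt n ω) ω) *
      varMatrixInvSqrt μ x i (βt n ω)

/-- `R_n = E(R̃_n)`, entrywise. -/
def meanEstCorr {m p : ℕ} {Ω : Type*} [MeasurableSpace Ω] (P : Measure Ω) (μ : ℝ → ℝ)
    (x : ℕ → Fin m → EuclideanSpace ℝ (Fin p)) (y : ℕ → Ω → Fin m → ℝ)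
    (βt : ℕ → Ω → EuclideanSpace ℝ (Fin p)) (n : ℕ) : Matrix (Fin m) (Fin m) ℝ :=
  Matrix.of fun j k => ∫ ω, estCorr μ x y βt n ω j k ∂P

/-- The random matrices `R n` converge to zero after centring at `c n`, elementwise in `L¹`. -/
def ElementwiseL1 {m : ℕ} {Ω : Type*} [MeasurableSpace Ω] (P : Measure Ω)
    (R : ℕ → Ω → Matrix (Fin m) (Fin m) ℝ) (c : ℕ → Matrix (Fin m) (Fin m) ℝ) : Prop :=
  ∀ j k, Tendsto (fun n => eLpNorm (fun ω => R n ω j k - c n j k) 1 P) atTop (𝓝 0)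

/-- The random matrices `R n` converge to zero after centring at `c n`, elementwise almost
surely. -/
def ElementwiseAS {m : ℕ} {Ω : Type*} [MeasurableSpace Ω] (P : Measure Ω)
    (R : ℕ → Ω → Matrix (Fin m) (Fin m) ℝ) (c : ℕ → Matrix (Fin m) (Fin m) ℝ) : Prop :=
  ∀ j k, ∀ᵐ ω ∂P, Tendsto (fun n => R n ω j k - c n j k) atTop (𝓝 0)

/-- Consistency of the estimated average correlation matrix computed from `βt`: the expectation
`R_n` exists, `R̃_n - R_n → 0` and `R̃_n - R̄_n → 0` elementwise in `L¹`, and both convergences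
are almost sure if the one in (C2) is. -/
structure CorrConsistent {m p : ℕ} {Ω : Type*} [MeasurableSpace Ω] (P : Measure Ω) (μ : ℝ → ℝ)
    (x : ℕ → Fin m → EuclideanSpace ℝ (Fin p)) (β₀ : EuclideanSpace ℝ (Fin p))
    (y : ℕ → Ω → Fin m → ℝ) (βt : ℕ → Ω → EuclideanSpace ℝ (Fin p)) : Prop where
  integrable : ∀ n j k, Integrable (fun ω => estCorr μ x y βt n ω j k) P
  l1_mean : ElementwiseL1 P (estCorr μ x y βt) (meanEstCorr P μ x y βt)
  l1_true : ElementwiseL1 P (estCorr μ x y βt) (avgTrueCorr P y)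
  as_mean : CondC2AS P μ x β₀ y →
    ElementwiseAS P (estCorr μ x y βt) (meanEstCorr P μ x y βt)
  as_true : CondC2AS P μ x β₀ y → ElementwiseAS P (estCorr μ x y βt) (avgTrueCorr P y)

end LongitudinalGEE

end

/-! Everything happens on the ellipsoids `B_n(r)`, handled through the quadratic form `quadIndep`,
that is `v ↦ vᵀ H_n v`.

Radius of the estimators. The link is increasing, so `v ⬝ᵥ g_n` decreases along each ray leaving
`β₀` in direction `v`, at a rate comparable to `vᵀ H_n v` inside the ellipsoid. A root outside
`B_n(r)` therefore forces `g_nᵀ H_n⁻¹ g_n ≥ m r² / 4` at `β₀` (`le_sum_sq_of_gIndep_eq_zero`).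
Orthogonality of martingale differences bounds the mean of that form by `m p`, and Markov's
inequality concludes (`IsPrelim.exists_radius`).

Consistency at `β₀`. The empirical correlation matrix of the `y_i^*` is the true average, plus the
average in (C2), plus an average of martingale differences with bounded moments of order `q = 1 +
δ/2`. The last tends to zero in `L¹` and almost surely by truncation, an `L¹`-bounded martingale and
Kronecker's lemma. (C2) improves to `L¹` by uniform integrability.

Passing from `β₀` to the estimator. For `β` in `B_n(r)` the predictors move by at most `(γ_n m
r²)^{1/2} → 0`, and `log μ'` is Lipschitz between them, so variance ratios tend to one uniformly.
Standardized residuals become `c Y + d` with `c` near one and squared shifts `d²` whose sum over all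
subjects stays bounded, hence vanishes after division by `n`. The resulting estimate
`CondIndep.eventually_abs_estCorr_sub_le` is deterministic and uniform in `ω` and in the estimator,
so it serves both modes of convergence (`corrConsistent_of_abs_sub_le`). It holds for each fixed
radius and tolerance, and a diagonal choice lets the radius grow slowly. -/

namespace LongitudinalGEE

/-- **Kronecker's lemma** for the weights `1 / (i + 1)`. -/
lemma tendsto_average_of_tendsto_sum_div {a : ℕ → ℝ} {l : ℝ}
    (h : Tendsto (fun n => ∑ i ∈ Finset.range n, a i / ((i : ℝ) + 1)) atTop (𝓝 l)) :
    Tendsto (fun n : ℕ => (n : ℝ)⁻¹ * ∑ i ∈ Finset.range n, a i) atTop (𝓝 0) := by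
  set s : ℕ → ℝ := fun n => ∑ i ∈ Finset.range n, a i / ((i : ℝ) + 1) with hs
  have key : ∀ n : ℕ, ∑ i ∈ Finset.range n, a i = n * s n - ∑ i ∈ Finset.range n, s i := by
    intro n
    induction n with
    | zero => simp
    | succ n ih =>
      have hn : (n : ℝ) + 1 ≠ 0 := by positivity
      have hsn : s (n + 1) = s n + a n / ((n : ℝ) + 1) := by
        simp only [hs, Finset.sum_range_succ]
      rw [Finset.sum_range_succ, Finset.sum_range_succ, ih, hsn]
      push_cast
      field_simp
      ring
  have hlim := h.sub h.cesaro
  rw [sub_self] at hlim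
  refine hlim.congr' ?_
  filter_upwards [eventually_gt_atTop 0] with n hn
  have hn' : (n : ℝ) ≠ 0 := by positivity
  rw [key]
  field_simp

/-! ### Laws of large numbers for martingale differences with bounded moments of order `q > 1`. -/

section LawOfLargeNumbers

variable {Ω : Type*} {m0 : MeasurableSpace Ω} {P : Measure Ω}

/-- Sums of square integrable martingale differences are orthogonal. -/
lemma integral_sq_sum_of_condExp_eq_zero [IsProbabilityMeasure P] (ℱ : Filtration ℕ m0)
    {e : ℕ → Ω → ℝ} (hm : ∀ i, StronglyMeasurable[ℱ (i + 1)] (e i)) (h2 : ∀ i, MemLp (e i) 2 P)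
    (h0 : ∀ i, P[e i | ℱ i] =ᵐ[P] 0) (n : ℕ) :
    ∫ ω, (∑ i ∈ Finset.range n, e i ω) ^ 2 ∂P = ∑ i ∈ Finset.range n, ∫ ω, (e i ω) ^ 2 ∂P := by
  induction n with
  | zero => simp
  | succ n ih =>
    set s : Ω → ℝ := fun ω => ∑ i ∈ Finset.range n, e i ω with hs
    have hsm : StronglyMeasurable[ℱ n] s := by
      refine Finset.stronglyMeasurable_fun_sum _ fun i hi => (hm i).mono (ℱ.mono ?_)
      exact Finset.mem_range.1 hi
    have hs2 : MemLp s 2 P := memLp_finsetSum _ fun i _ => h2 i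
    have hse : Integrable (s * e n) P := hs2.integrable_mul (h2 n)
    have hse' : Integrable (fun ω => 2 * (s ω * e n ω)) P := hse.const_mul 2
    have hsum : Integrable (fun ω => s ω ^ 2 + 2 * (s ω * e n ω)) P := hs2.integrable_sq.add hse'
    have hz : ∫ ω, s ω * e n ω ∂P = 0 := by
      have h1 : P[s * e n | ℱ n] =ᵐ[P] 0 := by
        refine (condExp_mul_of_stronglyMeasurable_left hsm hse
          ((h2 n).integrable one_le_two)).trans ?_
        filter_upwards [h0 n] with ω hω
        simp [hω]
      have h3 := integral_condExp (μ := P) (f := s * e n) (ℱ.le n)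
      rw [integral_congr_ae h1] at h3
      simpa using h3.symm
    have hexp : ∀ ω, (∑ i ∈ Finset.range (n + 1), e i ω) ^ 2
        = (s ω ^ 2 + 2 * (s ω * e n ω)) + e n ω ^ 2 := by
      intro ω
      rw [Finset.sum_range_succ]
      simp only [hs]
      ring
    simp_rw [hexp]
    rw [integral_add hsum (h2 n).integrable_sq,
      integral_add hs2.integrable_sq hse', integral_const_mul, hz,
      Finset.sum_range_succ, ← ih]
    ring

lemma integral_abs_le_sqrt_integral_sq [IsProbabilityMeasure P] {f : Ω → ℝ} (hf : MemLp f 2 P) :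
    ∫ ω, |f ω| ∂P ≤ √(∫ ω, f ω ^ 2 ∂P) := by
  have h := variance_nonneg |f| P
  rw [variance_eq_sub hf.abs] at h
  simp only [Pi.pow_apply, Pi.abs_apply, sq_abs] at h
  exact Real.le_sqrt_of_sq_le (by linarith)

/-- Conditional Jensen together with `(a - b)² ≤ 2a² + 2b²`; the crude constant 4 suffices. -/
lemma integral_sq_sub_condExp_le [IsProbabilityMeasure P] {m : MeasurableSpace Ω}
    {f : Ω → ℝ} (hf : MemLp f 2 P) :
    ∫ ω, (f ω - (P[f | m]) ω) ^ 2 ∂P ≤ 4 * ∫ ω, f ω ^ 2 ∂P := by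
  have hc : MemLp (P[f | m]) 2 P := hf.condExp one_le_two
  have h1 : ∫ ω, (P[f | m]) ω ^ 2 ∂P ≤ ∫ ω, f ω ^ 2 ∂P := by
    have := integral_norm_condExp_rpow_le (μ := P) (m := m) (p := 2) one_le_two (f := f)
      (by simpa using hf.integrable_sq)
    simpa using this
  calc ∫ ω, (f ω - (P[f | m]) ω) ^ 2 ∂P
      ≤ ∫ ω, (2 * f ω ^ 2 + 2 * (P[f | m]) ω ^ 2) ∂P := by
        refine integral_mono (hf.sub hc).integrable_sq
          ((hf.integrable_sq.const_mul 2).add (hc.integrable_sq.const_mul 2)) fun ω => ?_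
        dsimp only
        nlinarith [sq_nonneg (f ω + (P[f | m]) ω)]
    _ = 2 * ∫ ω, f ω ^ 2 ∂P + 2 * ∫ ω, (P[f | m]) ω ^ 2 ∂P := by
        rw [integral_add (hf.integrable_sq.const_mul 2) (hc.integrable_sq.const_mul 2),
          integral_const_mul, integral_const_mul]
    _ ≤ _ := by linarith

/-- Truncation of a real number at level `c`. -/
def clip (c t : ℝ) : ℝ := max (-c) (min c t)

lemma continuous_clip (c : ℝ) : Continuous (clip c) := by unfold clip; fun_prop

lemma abs_clip_le {c : ℝ} (hc : 0 ≤ c) (t : ℝ) : |clip c t| ≤ c := by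
  unfold clip
  rw [abs_le]
  exact ⟨le_max_left _ _, max_le (by linarith) (min_le_left _ _)⟩

lemma clip_eq_self {c t : ℝ} (h : |t| ≤ c) : clip c t = t := by
  rw [abs_le] at h
  unfold clip
  rw [min_eq_right h.2, max_eq_right h.1]

lemma clip_mem {c : ℝ} (hc : 0 ≤ c) (t : ℝ) : |clip c t| ≤ |t| ∧ |t - clip c t| ≤ |t| := by
  unfold clip
  rcases le_total c t with h | h
  · rw [min_eq_left h, max_eq_right (by linarith)]
    constructor <;> rw [abs_le, abs_of_nonneg (hc.trans h)] <;> constructor <;> linarith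
  · rw [min_eq_right h]
    rcases le_total (-c) t with h' | h'
    · rw [max_eq_right h']
      simp
    · rw [max_eq_left h']
      have ht : t ≤ 0 := by linarith
      constructor <;> rw [abs_le, abs_of_nonpos ht] <;> constructor <;> linarith

/-- Interpolation: `2 - q` of the powers are bounded by the level `c`, the other `q` by `|t|`. -/
lemma sq_clip_le {c q : ℝ} (hc : 0 < c) (hq1 : 1 < q) (hq2 : q ≤ 2) (t : ℝ) :
    clip c t ^ 2 ≤ c ^ (2 - q) * |t| ^ q := by
  rcases eq_or_ne (clip c t) 0 with h | h
  · rw [h, zero_pow two_ne_zero]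
    positivity
  · have hpos : 0 < |clip c t| := abs_pos.2 h
    calc clip c t ^ 2 = |clip c t| ^ (2 - q) * |clip c t| ^ q := by
          rw [← Real.rpow_add hpos, ← sq_abs]
          norm_num
      _ ≤ c ^ (2 - q) * |t| ^ q := by
          refine mul_le_mul ?_ ?_ (by positivity) (by positivity)
          · exact Real.rpow_le_rpow (abs_nonneg _) (abs_clip_le hc.le t) (by linarith)
          · exact Real.rpow_le_rpow (abs_nonneg _) (clip_mem hc.le t).1 (by linarith)

/-- The truncation error lives on `|t| > c`, where `|t| ^ (1 - q) ≤ c ^ (1 - q)` because `1 - q <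
0`. -/
lemma abs_sub_clip_le {c q : ℝ} (hc : 0 < c) (hq1 : 1 < q) (t : ℝ) :
    |t - clip c t| ≤ c ^ (1 - q) * |t| ^ q := by
  rcases le_or_gt |t| c with h | h
  · rw [clip_eq_self h]
    simp only [sub_self, abs_zero]
    positivity
  · have hpos : 0 < |t| := hc.trans h
    calc |t - clip c t| ≤ |t| := (clip_mem hc.le t).2
      _ = |t| ^ (1 - q) * |t| ^ q := by
          rw [← Real.rpow_add hpos]
          norm_num
      _ ≤ c ^ (1 - q) * |t| ^ q := by
          gcongr ?_ * _
          exact Real.rpow_le_rpow_of_nonpos hc h.le (by linarith)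

/-- `L¹` bound for weighted sums of martingale differences with bounded `q`-th moments,
`1 < q ≤ 2`. -/
lemma integral_abs_sum_martingaleDiff_le [IsProbabilityMeasure P] (ℱ : Filtration ℕ m0)
    {z : ℕ → Ω → ℝ} (hm : ∀ i, StronglyMeasurable[ℱ (i + 1)] (z i)) {q C : ℝ} (hq1 : 1 < q)
    (hq2 : q ≤ 2) (hz : ∀ i, Integrable (z i) P) (hint : ∀ i, Integrable (fun ω => |z i ω| ^ q) P)
    (hC : ∀ i, ∫ ω, |z i ω| ^ q ∂P ≤ C) {w : ℕ → ℝ} (hw : ∀ i, 0 ≤ w i) (n : ℕ) :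
    ∫ ω, |∑ i ∈ Finset.range n, w i * (z i ω - (P[z i | ℱ i]) ω)| ∂P ≤
      √(∑ i ∈ Finset.range n, w i ^ 2 * (4 * (((i : ℝ) + 1) ^ (2 - q) * C))) +
        ∑ i ∈ Finset.range n, w i * (2 * (((i : ℝ) + 1) ^ (1 - q) * C)) := by
  have hpos : ∀ i : ℕ, (0 : ℝ) < (i : ℝ) + 1 := fun i => by positivity
  -- Truncate at the growing level `i + 1` and recentre both pieces: `e` is square integrable and
  -- summed by orthogonality, while `f` is summed in `L¹` by the triangle inequality.
  set z' : ℕ → Ω → ℝ := fun i ω => clip ((i : ℝ) + 1) (z i ω) with hz'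
  set e : ℕ → Ω → ℝ := fun i ω => w i * (z' i ω - (P[z' i | ℱ i]) ω) with he
  set f : ℕ → Ω → ℝ := fun i ω => w i * ((z i ω - z' i ω) - (P[z i - z' i | ℱ i]) ω) with hf
  have hm' : ∀ i, StronglyMeasurable[ℱ (i + 1)] (z' i) := fun i =>
    (continuous_clip _).comp_stronglyMeasurable (hm i)
  have hz'2 : ∀ i, MemLp (z' i) 2 P := fun i =>
    (MemLp.of_bound (((hm' i).mono (ℱ.le _)).aestronglyMeasurable) ((i : ℝ) + 1)
      (Eventually.of_forall fun ω => abs_clip_le (hpos i).le _)).mono_exponent le_top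
  have hz'1 : ∀ i, Integrable (z' i) P := fun i => (hz'2 i).integrable one_le_two
  have he2 : ∀ i, MemLp (e i) 2 P := fun i =>
    ((hz'2 i).sub ((hz'2 i).condExp one_le_two)).const_mul (w i)
  have hem : ∀ i, StronglyMeasurable[ℱ (i + 1)] (e i) := fun i =>
    ((hm' i).sub (stronglyMeasurable_condExp.mono (ℱ.mono i.le_succ))).const_mul (w i)
  have he0 : ∀ i, P[e i | ℱ i] =ᵐ[P] 0 := by
    intro i
    have h1 : P[e i | ℱ i] =ᵐ[P] w i • P[z' i - P[z' i | ℱ i] | ℱ i] :=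
      condExp_smul (w i) (z' i - P[z' i | ℱ i]) (ℱ i)
    have h2 := condExp_sub (hz'1 i) (integrable_condExp (μ := P) (f := z' i) (m := ℱ i)) (ℱ i)
    have h3 : P[P[z' i | ℱ i] | ℱ i] = P[z' i | ℱ i] :=
      condExp_of_stronglyMeasurable (ℱ.le i) stronglyMeasurable_condExp integrable_condExp
    filter_upwards [h1, h2] with ω h1 h2
    rw [h1, Pi.smul_apply, h2, Pi.sub_apply, h3]
    simp
  have hf1 : ∀ i, Integrable (f i) P := fun i =>
    (((hz i).sub (hz'1 i)).sub integrable_condExp).const_mul (w i)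
  have hsplit : ∀ᵐ ω ∂P, ∀ i, w i * (z i ω - (P[z i | ℱ i]) ω) = e i ω + f i ω := by
    rw [ae_all_iff]
    intro i
    filter_upwards [condExp_sub (hz i) (hz'1 i) (ℱ i)] with ω h
    simp only [he, hf, h, Pi.sub_apply]
    ring
  have hs2 : MemLp (fun ω => ∑ i ∈ Finset.range n, e i ω) 2 P :=
    memLp_finsetSum _ fun i _ => he2 i
  have hfs : Integrable (fun ω => ∑ i ∈ Finset.range n, |f i ω|) P :=
    integrable_finsetSum _ fun i _ => (hf1 i).abs
  have hebound : ∀ i, ∫ ω, e i ω ^ 2 ∂P ≤ w i ^ 2 * (4 * (((i : ℝ) + 1) ^ (2 - q) * C)) := by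
    intro i
    simp only [he, mul_pow]
    rw [integral_const_mul]
    refine mul_le_mul_of_nonneg_left ?_ (sq_nonneg _)
    refine (integral_sq_sub_condExp_le (hz'2 i)).trans ?_
    refine mul_le_mul_of_nonneg_left ?_ (by norm_num)
    calc ∫ ω, z' i ω ^ 2 ∂P ≤ ∫ ω, ((i : ℝ) + 1) ^ (2 - q) * |z i ω| ^ q ∂P :=
          integral_mono (hz'2 i).integrable_sq ((hint i).const_mul _) fun ω =>
            sq_clip_le (hpos i) hq1 hq2 _
      _ ≤ _ := by
          rw [integral_const_mul]
          exact mul_le_mul_of_nonneg_left (hC i) (Real.rpow_nonneg (hpos i).le _)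
  have hfbound : ∀ i, ∫ ω, |f i ω| ∂P ≤ w i * (2 * (((i : ℝ) + 1) ^ (1 - q) * C)) := by
    intro i
    have hd : Integrable (z i - z' i) P := (hz i).sub (hz'1 i)
    have hA : ∫ ω, |(z i - z' i) ω| ∂P ≤ ((i : ℝ) + 1) ^ (1 - q) * C := by
      calc ∫ ω, |(z i - z' i) ω| ∂P ≤ ∫ ω, ((i : ℝ) + 1) ^ (1 - q) * |z i ω| ^ q ∂P :=
            integral_mono hd.abs ((hint i).const_mul _) fun ω =>
              abs_sub_clip_le (hpos i) hq1 _
        _ ≤ _ := by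
            rw [integral_const_mul]
            exact mul_le_mul_of_nonneg_left (hC i) (Real.rpow_nonneg (hpos i).le _)
    have hB := integral_abs_condExp_le (μ := P) (m := ℱ i) (z i - z' i)
    simp only [hf, abs_mul, abs_of_nonneg (hw i)]
    rw [integral_const_mul]
    refine mul_le_mul_of_nonneg_left ?_ (hw i)
    calc ∫ ω, |z i ω - z' i ω - (P[z i - z' i | ℱ i]) ω| ∂P
        ≤ ∫ ω, (|(z i - z' i) ω| + |(P[z i - z' i | ℱ i]) ω|) ∂P :=
          integral_mono (hd.sub integrable_condExp).abs (hd.abs.add integrable_condExp.abs)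
            fun ω => abs_sub _ _
      _ = ∫ ω, |(z i - z' i) ω| ∂P + ∫ ω, |(P[z i - z' i | ℱ i]) ω| ∂P :=
          integral_add hd.abs integrable_condExp.abs
      _ ≤ _ := by linarith
  calc ∫ ω, |∑ i ∈ Finset.range n, w i * (z i ω - (P[z i | ℱ i]) ω)| ∂P
      ≤ ∫ ω, (|∑ i ∈ Finset.range n, e i ω| + ∑ i ∈ Finset.range n, |f i ω|) ∂P := by
        refine integral_mono_of_nonneg (Eventually.of_forall fun ω => abs_nonneg _)
          ((hs2.integrable one_le_two).abs.add hfs) ?_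
        filter_upwards [hsplit] with ω hω
        simp only [hω, Finset.sum_add_distrib]
        exact (abs_add_le _ _).trans (by gcongr; exact Finset.abs_sum_le_sum_abs _ _)
    _ = ∫ ω, |∑ i ∈ Finset.range n, e i ω| ∂P + ∑ i ∈ Finset.range n, ∫ ω, |f i ω| ∂P := by
        rw [integral_add (hs2.integrable one_le_two).abs hfs,
          integral_finsetSum _ fun i _ => (hf1 i).abs]
    _ ≤ _ := by
        refine add_le_add ?_ (Finset.sum_le_sum fun i _ => hfbound i)
        refine (integral_abs_le_sqrt_integral_sq hs2).trans (Real.sqrt_le_sqrt ?_)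
        rw [integral_sq_sum_of_condExp_eq_zero ℱ hem he2 he0]
        exact Finset.sum_le_sum fun i _ => hebound i

/-- Averages of martingale differences with bounded `q`-th moments tend to zero in `L¹`. -/
lemma tendsto_integral_abs_average_martingaleDiff [IsProbabilityMeasure P] (ℱ : Filtration ℕ m0)
    {z : ℕ → Ω → ℝ} (hm : ∀ i, StronglyMeasurable[ℱ (i + 1)] (z i)) {q C : ℝ} (hq1 : 1 < q)
    (hq2 : q ≤ 2) (hz : ∀ i, Integrable (z i) P) (hint : ∀ i, Integrable (fun ω => |z i ω| ^ q) P)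
    (hC : ∀ i, ∫ ω, |z i ω| ^ q ∂P ≤ C) :
    Tendsto (fun n : ℕ => ∫ ω, |(n : ℝ)⁻¹ *
      ∑ i ∈ Finset.range n, (z i ω - (P[z i | ℱ i]) ω)| ∂P) atTop (𝓝 0) := by
  have hC0 : 0 ≤ C := (integral_nonneg fun ω => by positivity).trans (hC 0)
  have hpos : ∀ i : ℕ, (0 : ℝ) < (i : ℝ) + 1 := fun i => by positivity
  have hdecay : Tendsto (fun i : ℕ => ((i : ℝ) + 1) ^ (1 - q) * C) atTop (𝓝 0) := by
    have h1 : Tendsto (fun i : ℕ => (i : ℝ) + 1) atTop atTop :=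
      tendsto_atTop_add_const_right _ _ tendsto_natCast_atTop_atTop
    have h2 := (tendsto_rpow_neg_atTop (y := q - 1) (by linarith)).comp h1
    simpa [Function.comp_def] using h2.mul_const C
  have hces := hdecay.cesaro
  -- With all weights `1/n`, both terms of the bound are controlled by this Cesàro mean: in the
  -- square root, one factor `i + 1 ≤ n` cancels one `1/n`.
  set t : ℕ → ℝ := fun n => (n : ℝ)⁻¹ * ∑ i ∈ Finset.range n, ((i : ℝ) + 1) ^ (1 - q) * C with ht
  have hlim : Tendsto (fun n => √(4 * t n) + 2 * t n) atTop (𝓝 0) := by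
    have h1 : Tendsto (fun n => √(4 * t n)) atTop (𝓝 (√(4 * 0))) := (hces.const_mul 4).sqrt
    simpa using h1.add (hces.const_mul 2)
  refine squeeze_zero (fun n => integral_nonneg fun ω => abs_nonneg _) (fun n => ?_) hlim
  have hmain := integral_abs_sum_martingaleDiff_le ℱ hm hq1 hq2 hz hint hC
    (w := fun _ => (n : ℝ)⁻¹) (fun _ => by positivity) n
  simp only [Finset.mul_sum] at hmain ⊢
  refine hmain.trans (add_le_add (Real.sqrt_le_sqrt ?_) (le_of_eq ?_))
  · simp only [ht, Finset.mul_sum]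
    refine Finset.sum_le_sum fun i hi => ?_
    have hin : (i : ℝ) + 1 ≤ n := by exact_mod_cast Finset.mem_range.1 hi
    have hn : (0 : ℝ) < n := (hpos i).trans_le hin
    have hsp : ((i : ℝ) + 1) ^ (2 - q) = ((i : ℝ) + 1) * ((i : ℝ) + 1) ^ (1 - q) := by
      rw [show (2 : ℝ) - q = 1 + (1 - q) by ring, Real.rpow_add (hpos i), Real.rpow_one]
    have hA : 0 ≤ ((i : ℝ) + 1) ^ (1 - q) * C := mul_nonneg (Real.rpow_nonneg (hpos i).le _) hC0
    rw [hsp]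
    calc (n : ℝ)⁻¹ ^ 2 * (4 * (((i : ℝ) + 1) * ((i : ℝ) + 1) ^ (1 - q) * C))
        = ((n : ℝ)⁻¹ ^ 2 * (4 * (((i : ℝ) + 1) ^ (1 - q) * C))) * ((i : ℝ) + 1) := by ring
      _ ≤ ((n : ℝ)⁻¹ ^ 2 * (4 * (((i : ℝ) + 1) ^ (1 - q) * C))) * n := by gcongr
      _ = _ := by field_simp
  · simp only [ht, Finset.mul_sum]
    exact Finset.sum_congr rfl fun i _ => by ring

/-- Averages of martingale differences with bounded `q`-th moments tend to zero almost surely. -/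
lemma ae_tendsto_average_martingaleDiff [IsProbabilityMeasure P] (ℱ : Filtration ℕ m0)
    {z : ℕ → Ω → ℝ} (hm : ∀ i, StronglyMeasurable[ℱ (i + 1)] (z i)) {q C : ℝ} (hq1 : 1 < q)
    (hq2 : q ≤ 2) (hz : ∀ i, Integrable (z i) P) (hint : ∀ i, Integrable (fun ω => |z i ω| ^ q) P)
    (hC : ∀ i, ∫ ω, |z i ω| ^ q ∂P ≤ C) :
    ∀ᵐ ω ∂P, Tendsto (fun n : ℕ => (n : ℝ)⁻¹ *
      ∑ i ∈ Finset.range n, (z i ω - (P[z i | ℱ i]) ω)) atTop (𝓝 0) := by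
  have hC0 : 0 ≤ C := (integral_nonneg fun ω => by positivity).trans (hC 0)
  have hpos : ∀ i : ℕ, (0 : ℝ) < (i : ℝ) + 1 := fun i => by positivity
  -- The weights `1/(i + 1)` reduce both terms of the `L¹` bound to `∑ (i + 1)^(-q) < ∞`, so this
  -- martingale is `L¹`-bounded and converges; Kronecker's lemma then gives the averages.
  set M : ℕ → Ω → ℝ := fun n ω =>
    ∑ i ∈ Finset.range n, ((i : ℝ) + 1)⁻¹ * (z i ω - (P[z i | ℱ i]) ω) with hM
  have hdi : ∀ i : ℕ, Integrable (fun ω => ((i : ℝ) + 1)⁻¹ * (z i ω - (P[z i | ℱ i]) ω)) P := fun i =>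
    ((hz i).sub integrable_condExp).const_mul _
  have hMi : ∀ n, Integrable (M n) P := fun n => integrable_finsetSum _ fun i _ => hdi i
  have hmart : Martingale M ℱ P := by
    refine martingale_of_condExp_sub_eq_zero_nat (fun n => ?_) hMi fun n => ?_
    · refine Finset.stronglyMeasurable_fun_sum _ fun i hi => ?_
      have hi' : i + 1 ≤ n := Finset.mem_range.1 hi
      exact (((hm i).mono (ℱ.mono hi')).sub
        (stronglyMeasurable_condExp.mono (ℱ.mono (i.le_succ.trans hi')))).const_mul _
    · have hstep : M (n + 1) - M n = ((n : ℝ) + 1)⁻¹ • (z n - P[z n | ℱ n]) := by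
        ext ω
        simp [hM, Finset.sum_range_succ]
      rw [hstep]
      have h1 := condExp_smul (μ := P) ((n : ℝ) + 1)⁻¹ (z n - P[z n | ℱ n]) (ℱ n)
      have h2 := condExp_sub (hz n) (integrable_condExp (μ := P) (f := z n) (m := ℱ n)) (ℱ n)
      have h3 : P[P[z n | ℱ n] | ℱ n] = P[z n | ℱ n] :=
        condExp_of_stronglyMeasurable (ℱ.le n) stronglyMeasurable_condExp integrable_condExp
      filter_upwards [h1, h2] with ω h1 h2
      rw [h1, Pi.smul_apply, h2, Pi.sub_apply, h3]
      simp
  have hsum : Summable fun i : ℕ => ((i : ℝ) + 1) ^ (-q) * C := by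
    have h1 : Summable fun i : ℕ => ((i : ℝ)) ^ (-q) := Real.summable_nat_rpow.2 (by linarith)
    have h2 := (summable_nat_add_iff 1).2 h1
    push_cast at h2
    exact h2.mul_right C
  set T := ∑' i : ℕ, ((i : ℝ) + 1) ^ (-q) * C with hT
  have hTle : ∀ n, ∑ i ∈ Finset.range n, ((i : ℝ) + 1) ^ (-q) * C ≤ T := fun n =>
    hsum.sum_le_tsum _ fun i _ => mul_nonneg (Real.rpow_nonneg (hpos i).le _) hC0
  have hbound : ∀ n, ∫ ω, |M n ω| ∂P ≤ √(4 * T) + 2 * T := by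
    intro n
    refine (integral_abs_sum_martingaleDiff_le ℱ hm hq1 hq2 hz hint hC
      (w := fun i => ((i : ℝ) + 1)⁻¹) (fun i => by positivity) n).trans
      (add_le_add (Real.sqrt_le_sqrt ?_) ?_)
    · refine le_trans (le_of_eq ?_) (mul_le_mul_of_nonneg_left (hTle n) (by norm_num : (0:ℝ) ≤ 4))
      rw [Finset.mul_sum]
      refine Finset.sum_congr rfl fun i _ => ?_
      have : ((i : ℝ) + 1) ^ (2 - q) = ((i : ℝ) + 1) ^ 2 * ((i : ℝ) + 1) ^ (-q) := by
        rw [sub_eq_add_neg, Real.rpow_add (hpos i)]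
        norm_num
      rw [this]
      have := (hpos i).ne'
      field_simp
    · refine le_trans (le_of_eq ?_) (mul_le_mul_of_nonneg_left (hTle n) (by norm_num : (0:ℝ) ≤ 2))
      rw [Finset.mul_sum]
      refine Finset.sum_congr rfl fun i _ => ?_
      have : ((i : ℝ) + 1) ^ (1 - q) = ((i : ℝ) + 1) * ((i : ℝ) + 1) ^ (-q) := by
        rw [sub_eq_add_neg, Real.rpow_add (hpos i)]
        norm_num
      rw [this]
      have := (hpos i).ne'
      field_simp
  have hconv := hmart.submartingale.exists_ae_tendsto_of_bdd
    (R := (√(4 * T) + 2 * T).toNNReal) fun n => by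
      rw [eLpNorm_one_eq_lintegral_enorm, ← ofReal_integral_norm_eq_lintegral_enorm (hMi n)]
      exact ENNReal.ofReal_le_ofReal (hbound n)
  filter_upwards [hconv] with ω ⟨l, hω⟩
  refine tendsto_average_of_tendsto_sum_div (l := l) (hω.congr fun n => ?_)
  exact Finset.sum_congr rfl fun i _ => by rw [div_eq_inv_mul]

/-- A sequence which is bounded in `L^q` for some `q > 1` and tends to zero in measure tends to
zero in `L¹`. -/
lemma tendsto_eLpNorm_one_of_tendstoInMeasure [IsProbabilityMeasure P] {f : ℕ → Ω → ℝ}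
    {q C : ℝ} (hq : 1 < q) (hf : ∀ n, AEStronglyMeasurable (f n) P)
    (hC : ∀ n, eLpNorm (f n) (ENNReal.ofReal q) P ≤ ENNReal.ofReal C)
    (h : TendstoInMeasure P f atTop (fun _ => 0)) :
    Tendsto (fun n => eLpNorm (f n) 1 P) atTop (𝓝 0) := by
  have hq' : (1 : ℝ≥0∞) ≤ ENNReal.ofReal q := by
    rw [← ENNReal.ofReal_one]
    exact ENNReal.ofReal_le_ofReal hq.le
  set a : ℝ := 1 - 1 / q with ha
  have ha0 : 0 < a := by
    have : 1 / q < 1 := by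
      rw [div_lt_one (by linarith)]
      exact hq
    rw [ha]
    linarith
  -- Hölder on a set `s` gives `‖f 1_s‖₁ ≤ ‖f‖_q P(s)^(1 - 1/q)`; the claim is then Vitali's
  -- theorem.
  have hui : UnifIntegrable f 1 P := by
    intro ε hε
    set D : ℝ := max C 1 with hD
    have hD0 : 0 < D := lt_of_lt_of_le one_pos (le_max_right _ _)
    refine ⟨(ε / D) ^ (1 / a), by positivity, fun n s hs hPs => ?_⟩
    rw [eLpNorm_indicator_eq_eLpNorm_restrict hs]
    refine (eLpNorm_le_eLpNorm_mul_rpow_measure_univ hq' ((hf n).restrict)).trans ?_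
    rw [Measure.restrict_apply_univ, ENNReal.toReal_one, ENNReal.toReal_ofReal (by linarith),
      one_div_one, ← ha]
    calc eLpNorm (f n) (ENNReal.ofReal q) (P.restrict s) * P s ^ a
        ≤ ENNReal.ofReal D * ENNReal.ofReal ((ε / D) ^ (1 / a)) ^ a := by
          gcongr
          exact (eLpNorm_mono_measure _ Measure.restrict_le_self).trans
            ((hC n).trans (ENNReal.ofReal_le_ofReal (le_max_left _ _)))
      _ = ENNReal.ofReal ε := by
          rw [ENNReal.ofReal_rpow_of_nonneg (by positivity) ha0.le,
            ← ENNReal.ofReal_mul hD0.le, ← Real.rpow_mul (by positivity),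
            one_div_mul_cancel ha0.ne', Real.rpow_one]
          congr 1
          field_simp
  have := tendsto_Lp_finite_of_tendstoInMeasure (μ := P) le_rfl ENNReal.one_ne_top hf
    (g := fun _ => 0) MemLp.zero' hui h
  simpa [Pi.sub_def] using this

end LawOfLargeNumbers

/-! ### Linear algebra of `H_n`: quadratic form, leverage, orthonormal basis. -/

section Design

variable {m p : ℕ} {μ : ℝ → ℝ} {x : ℕ → Fin m → EuclideanSpace ℝ (Fin p)}
  {B : Set (EuclideanSpace ℝ (Fin p))} {β₀ : EuclideanSpace ℝ (Fin p)}

/-- The quadratic form `v ↦ vᵀ H_n v`, written as a sum. -/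
noncomputable def quadIndep (μ : ℝ → ℝ) (x : ℕ → Fin m → EuclideanSpace ℝ (Fin p))
    (β₀ : EuclideanSpace ℝ (Fin p)) (n : ℕ) (v : EuclideanSpace ℝ (Fin p)) : ℝ :=
  ∑ i ∈ Finset.range n, ∑ j, sigmaSq μ x i j β₀ * (x i j ⬝ᵥ v) ^ 2

lemma sigmaSq_pos (hpos : ∀ t, 0 < deriv μ t) (i : ℕ) (j : Fin m)
    (β : EuclideanSpace ℝ (Fin p)) : 0 < sigmaSq μ x i j β :=
  hpos _

lemma theta_sub (i : ℕ) (j : Fin m) (β β' : EuclideanSpace ℝ (Fin p)) :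
    theta x i j β - theta x i j β' = x i j ⬝ᵥ (β - β') := by
  simp [theta, dotProduct_sub]

lemma theta_add_smul (i : ℕ) (j : Fin m) (β v : EuclideanSpace ℝ (Fin p)) (s : ℝ) :
    theta x i j (β + s • v) = theta x i j β + s * (x i j ⬝ᵥ v) := by
  simp [theta, dotProduct_add, dotProduct_smul]

lemma quadIndep_smul (n : ℕ) (s : ℝ) (v : EuclideanSpace ℝ (Fin p)) :
    quadIndep μ x β₀ n (s • v) = s ^ 2 * quadIndep μ x β₀ n v := by
  simp only [quadIndep, Finset.mul_sum, WithLp.ofLp_smul, dotProduct_smul,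
    smul_eq_mul]
  refine Finset.sum_congr rfl fun i _ => Finset.sum_congr rfl fun j _ => by ring

lemma quadIndep_nonneg (hpos : ∀ t, 0 < deriv μ t) (n : ℕ) (v : EuclideanSpace ℝ (Fin p)) :
    0 ≤ quadIndep μ x β₀ n v :=
  Finset.sum_nonneg fun _ _ => Finset.sum_nonneg fun _ _ =>
    mul_nonneg (hpos _).le (sq_nonneg _)

/-- Substitute for the leverage bound at those `n` for which `H_n` may be singular. -/
lemma sigmaSq_mul_sq_le_quadIndep (hpos : ∀ t, 0 < deriv μ t) {n i : ℕ} (hi : i < n) (j : Fin m)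
    (v : EuclideanSpace ℝ (Fin p)) :
    sigmaSq μ x i j β₀ * (x i j ⬝ᵥ v) ^ 2 ≤ quadIndep μ x β₀ n v := by
  have h0 : ∀ i j, 0 ≤ sigmaSq μ x i j β₀ * (x i j ⬝ᵥ v) ^ 2 := fun i j =>
    mul_nonneg (hpos _).le (sq_nonneg _)
  refine (Finset.single_le_sum (f := fun j => sigmaSq μ x i j β₀ * (x i j ⬝ᵥ v) ^ 2)
    (fun j _ => h0 i j) (Finset.mem_univ j)).trans ?_
  exact Finset.single_le_sum (f := fun i => ∑ j, sigmaSq μ x i j β₀ * (x i j ⬝ᵥ v) ^ 2)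
    (fun i _ => Finset.sum_nonneg fun j _ => h0 i j) (Finset.mem_range.2 hi)

lemma dotProduct_HIndep_mulVec (n : ℕ) (v w : Fin p → ℝ) :
    w ⬝ᵥ (HIndep μ x β₀ n *ᵥ v) =
      ∑ i ∈ Finset.range n, ∑ j, sigmaSq μ x i j β₀ * (x i j ⬝ᵥ w) * (x i j ⬝ᵥ v) := by
  rw [HIndep, Matrix.sum_mulVec, dotProduct_sum]
  refine Finset.sum_congr rfl fun i _ => ?_
  rw [← Matrix.mulVec_mulVec, ← Matrix.mulVec_mulVec, dotProduct_mulVec, vecMul_transpose]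
  simp only [dotProduct, varMatrix, mulVec_diagonal]
  refine Finset.sum_congr rfl fun j _ => ?_
  simp only [mulVec, dotProduct, designMatrix, Matrix.of_apply]
  ring

lemma quadIndep_eq_dotProduct (n : ℕ) (v : EuclideanSpace ℝ (Fin p)) :
    quadIndep μ x β₀ n v = v ⬝ᵥ (HIndep μ x β₀ n *ᵥ v) := by
  rw [dotProduct_HIndep_mulVec, quadIndep]
  refine Finset.sum_congr rfl fun i _ => Finset.sum_congr rfl fun j _ => by ring

lemma posSemidef_HIndep (hpos : ∀ t, 0 < deriv μ t) (n : ℕ) : (HIndep μ x β₀ n).PosSemidef := by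
  refine Matrix.posSemidef_sum _ fun i _ => ?_
  have hd : (varMatrix μ x i β₀).PosSemidef :=
    Matrix.PosSemidef.diagonal fun j => (hpos _).le
  have := hd.conjTranspose_mul_mul_same (designMatrix x i)
  rwa [Matrix.conjTranspose_eq_transpose_of_trivial] at this

lemma sqrt_HIndep_mul_self (hpos : ∀ t, 0 < deriv μ t) (n : ℕ) :
    CFC.sqrt (HIndep μ x β₀ n) * CFC.sqrt (HIndep μ x β₀ n) = HIndep μ x β₀ n :=
  CFC.sqrt_mul_sqrt_self _ (Matrix.nonneg_iff_posSemidef.2 (posSemidef_HIndep hpos n))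

lemma transpose_sqrt_HIndep (n : ℕ) :
    (CFC.sqrt (HIndep μ x β₀ n))ᵀ = CFC.sqrt (HIndep μ x β₀ n) := by
  have h := (Matrix.nonneg_iff_posSemidef.1 (CFC.sqrt_nonneg (HIndep μ x β₀ n))).isHermitian
  rwa [Matrix.IsHermitian, Matrix.conjTranspose_eq_transpose_of_trivial] at h

lemma norm_sqrt_HIndep_mulVec_sq (hpos : ∀ t, 0 < deriv μ t) (n : ℕ)
    (v : EuclideanSpace ℝ (Fin p)) :
    ‖WithLp.toLp 2 (CFC.sqrt (HIndep μ x β₀ n) *ᵥ v)‖ ^ 2 = quadIndep μ x β₀ n v := by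
  have h : quadIndep μ x β₀ n v =
      v ⬝ᵥ ((CFC.sqrt (HIndep μ x β₀ n) * CFC.sqrt (HIndep μ x β₀ n)) *ᵥ v) := by
    rw [sqrt_HIndep_mul_self hpos, quadIndep_eq_dotProduct]
  rw [h, EuclideanSpace.norm_sq_eq, ← Matrix.mulVec_mulVec, dotProduct_mulVec (v : Fin p → ℝ),
    ← mulVec_transpose, transpose_sqrt_HIndep]
  simp [dotProduct, sq]

/-- Replaces the matrix square root by a sum of squares, the form in which the ellipsoids are used
below. -/
lemma mem_ballIndep_iff (hpos : ∀ t, 0 < deriv μ t) {n : ℕ} {r : ℝ} (hr : 0 ≤ r)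
    {β : EuclideanSpace ℝ (Fin p)} :
    β ∈ ballIndep μ x B β₀ n r ↔ β ∈ B ∧ quadIndep μ x β₀ n (β - β₀) ≤ m * r ^ 2 := by
  rw [ballIndep, Set.mem_ofPred_eq, ← norm_sqrt_HIndep_mulVec_sq hpos,
    ← Real.sq_sqrt (Nat.cast_nonneg (α := ℝ) m), ← mul_pow, Real.sqrt_sq (by positivity),
    pow_le_pow_iff_left₀ (norm_nonneg _) (by positivity) two_ne_zero]

lemma lambdaMin_mul_norm_sq_le (hpos : ∀ t, 0 < deriv μ t) (n : ℕ)
    (v : EuclideanSpace ℝ (Fin p)) :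
    lambdaMin (HIndep μ x β₀ n) * ‖v‖ ^ 2 ≤ quadIndep μ x β₀ n v := by
  have hH := (posSemidef_HIndep (x := x) (β₀ := β₀) hpos n)
  have hle : algebraMap ℝ (Matrix (Fin p) (Fin p) ℝ) (lambdaMin (HIndep μ x β₀ n))
      ≤ HIndep μ x β₀ n := by
    rw [algebraMap_le_iff_le_spectrum (ha := hH.isHermitian)]
    intro t ht
    exact csInf_le (Matrix.finite_real_spectrum).bddBelow ht
  have h := (Matrix.le_iff.1 hle).dotProduct_mulVec_nonneg (v : Fin p → ℝ)
  rw [Algebra.algebraMap_eq_smul_one, Matrix.sub_mulVec, dotProduct_sub, smul_mulVec,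
    one_mulVec, dotProduct_smul, star_trivial, ← quadIndep_eq_dotProduct] at h
  rw [EuclideanSpace.norm_sq_eq]
  simp only [dotProduct, smul_eq_mul, Real.norm_eq_abs, sq_abs] at h ⊢
  simp only [sq]
  linarith

lemma posDef_HIndep (hpos : ∀ t, 0 < deriv μ t) {n : ℕ} (h : 0 < lambdaMin (HIndep μ x β₀ n)) :
    (HIndep μ x β₀ n).PosDef := by
  refine Matrix.PosDef.of_dotProduct_mulVec_pos (posSemidef_HIndep hpos n).isHermitian
    fun v hv => ?_
  have := lambdaMin_mul_norm_sq_le (x := x) (β₀ := β₀) hpos n (WithLp.toLp 2 v)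
  rw [quadIndep_eq_dotProduct] at this
  refine lt_of_lt_of_le (mul_pos h (pow_pos (norm_pos_iff.2 ?_) 2)) this
  simpa using hv

/-- Cauchy–Schwarz for the inner product of `H_n`: `x_ij ⬝ᵥ v` is the product of `v` with `w = H_n⁻¹
x_ij`, whose squared norm `x_ijᵀ H_n⁻¹ x_ij` is at most `γ_n`. -/
lemma sq_dotProduct_le_gammaIndep_mul (hpos : ∀ t, 0 < deriv μ t) {n : ℕ}
    (hH : (HIndep μ x β₀ n).PosDef) {i : ℕ} (hi : i < n) (j : Fin m)
    (v : EuclideanSpace ℝ (Fin p)) :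
    (x i j ⬝ᵥ v) ^ 2 ≤ gammaIndep μ x β₀ n * quadIndep μ x β₀ n v := by
  set H := HIndep μ x β₀ n with hHdef
  have hdet : IsUnit H.det := (Matrix.isUnit_iff_isUnit_det H).1 hH.isUnit
  set w : Fin p → ℝ := H⁻¹ *ᵥ x i j with hw
  have hHw : H *ᵥ w = x i j := by
    rw [hw, mulVec_mulVec, Matrix.mul_nonsing_inv _ hdet, one_mulVec]
  have h1 : ∀ u : Fin p → ℝ, u ⬝ᵥ (x i j) = ∑ q ∈ Finset.range n ×ˢ Finset.univ,
      sigmaSq μ x q.1 q.2 β₀ * (x q.1 q.2 ⬝ᵥ u) * (x q.1 q.2 ⬝ᵥ w) := by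
    intro u
    rw [← hHw, hHdef, dotProduct_HIndep_mulVec, Finset.sum_product]
  have hquad : quadIndep μ x β₀ n v = ∑ q ∈ Finset.range n ×ˢ Finset.univ,
      (√(sigmaSq μ x q.1 q.2 β₀) * (x q.1 q.2 ⬝ᵥ v)) ^ 2 := by
    rw [quadIndep, Finset.sum_product]
    refine Finset.sum_congr rfl fun i _ => Finset.sum_congr rfl fun j _ => ?_
    rw [mul_pow, Real.sq_sqrt (sigmaSq_pos hpos _ _ _).le]
  have hgam : x i j ⬝ᵥ w = ∑ q ∈ Finset.range n ×ˢ Finset.univ,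
      (√(sigmaSq μ x q.1 q.2 β₀) * (x q.1 q.2 ⬝ᵥ w)) ^ 2 := by
    rw [dotProduct_comm, h1 w]
    refine Finset.sum_congr rfl fun q _ => ?_
    rw [mul_pow, Real.sq_sqrt (sigmaSq_pos hpos _ _ _).le]
    ring
  have hcs := Finset.sum_mul_sq_le_sq_mul_sq (Finset.range n ×ˢ Finset.univ)
    (fun q => √(sigmaSq μ x q.1 q.2 β₀) * (x q.1 q.2 ⬝ᵥ v))
    (fun q => √(sigmaSq μ x q.1 q.2 β₀) * (x q.1 q.2 ⬝ᵥ w))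
  rw [← hquad, ← hgam] at hcs
  have hle : x i j ⬝ᵥ w ≤ gammaIndep μ x β₀ n :=
    le_ciSup (f := fun q : Fin n × Fin m =>
      x q.1 q.2 ⬝ᵥ ((HIndep μ x β₀ n)⁻¹ *ᵥ x q.1 q.2)) (Set.finite_range _).bddAbove (⟨i, hi⟩, j)
  have hvx : x i j ⬝ᵥ v = ∑ q ∈ Finset.range n ×ˢ Finset.univ,
      √(sigmaSq μ x q.1 q.2 β₀) * (x q.1 q.2 ⬝ᵥ v) *
        (√(sigmaSq μ x q.1 q.2 β₀) * (x q.1 q.2 ⬝ᵥ w)) := by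
    rw [dotProduct_comm, h1 v]
    refine Finset.sum_congr rfl fun q _ => ?_
    rw [mul_mul_mul_comm, Real.mul_self_sqrt (sigmaSq_pos hpos _ _ _).le]
    ring
  rw [← hvx] at hcs
  calc (x i j ⬝ᵥ v) ^ 2 ≤ quadIndep μ x β₀ n v * (x i j ⬝ᵥ w) := hcs
    _ ≤ quadIndep μ x β₀ n v * gammaIndep μ x β₀ n :=
        mul_le_mul_of_nonneg_left hle (quadIndep_nonneg hpos n v)
    _ = _ := mul_comm _ _

/-- A basis of `ℝᵖ` which is orthonormal for `H_n`, with the Cauchy–Schwarz inequality between the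
`H_n`-norm and the dual norm. -/
lemma exists_quadIndep_orthonormal (hpos : ∀ t, 0 < deriv μ t) {n : ℕ}
    (hH : (HIndep μ x β₀ n).PosDef) :
    ∃ u : Fin p → EuclideanSpace ℝ (Fin p), (∀ k, quadIndep μ x β₀ n (u k) = 1) ∧
      ∀ (v : EuclideanSpace ℝ (Fin p)) (g : Fin p → ℝ),
        (v ⬝ᵥ g) ^ 2 ≤ quadIndep μ x β₀ n v * ∑ k, (u k ⬝ᵥ g) ^ 2 := by
  set S := CFC.sqrt (HIndep μ x β₀ n) with hS
  have hSS : S * S = HIndep μ x β₀ n := sqrt_HIndep_mul_self hpos n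
  have hST : Sᵀ = S := transpose_sqrt_HIndep n
  have hdet : IsUnit S.det := by
    have h : IsUnit (S * S).det := by
      rw [hSS]
      exact (Matrix.isUnit_iff_isUnit_det _).1 hH.isUnit
    rw [Matrix.det_mul] at h
    exact isUnit_of_mul_isUnit_left h
  have hIT : S⁻¹ᵀ = S⁻¹ := by rw [Matrix.transpose_nonsing_inv, hST]
  -- The columns of `H_n^{-1/2}`; the dual form `∑ (u_k ⬝ᵥ g)²` is then `gᵀ H_n⁻¹ g`.
  refine ⟨fun k => WithLp.toLp 2 (S⁻¹ *ᵥ Pi.single k 1), fun k => ?_, fun v g => ?_⟩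
  · rw [← norm_sqrt_HIndep_mulVec_sq hpos, ← hS]
    simp only [mulVec_mulVec, Matrix.mul_nonsing_inv _ hdet, one_mulVec]
    rw [EuclideanSpace.norm_sq_eq]
    simp [Pi.single_apply, ite_pow]
  · have h1 : ∀ k, (S⁻¹ *ᵥ Pi.single k 1) ⬝ᵥ g = (S⁻¹ *ᵥ g) k := by
      intro k
      rw [dotProduct_comm, dotProduct_mulVec, ← mulVec_transpose, hIT, dotProduct_single_one]
    have h2 : v ⬝ᵥ g = (S *ᵥ v) ⬝ᵥ (S⁻¹ *ᵥ g) := by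
      rw [dotProduct_mulVec, ← mulVec_transpose, hIT, mulVec_mulVec, Matrix.nonsing_inv_mul _ hdet,
        one_mulVec]
    simp only [h1]
    rw [h2, ← norm_sqrt_HIndep_mulVec_sq hpos, ← hS, EuclideanSpace.norm_sq_eq]
    simpa [dotProduct] using
      Finset.sum_mul_sq_le_sq_mul_sq Finset.univ (S *ᵥ v) (S⁻¹ *ᵥ g)

end Design

/-! ### Uniform control of variances and standardized residuals on the ellipsoids. -/

section LocalBehaviour

variable {m p : ℕ} {μ : ℝ → ℝ} {x : ℕ → Fin m → EuclideanSpace ℝ (Fin p)}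
  {B : Set (EuclideanSpace ℝ (Fin p))} {β₀ : EuclideanSpace ℝ (Fin p)}

lemma CondIndep.tendsto_gammaIndep (hC : CondIndep μ x B β₀) :
    Tendsto (gammaIndep μ x β₀) atTop (𝓝 0) := by
  refine squeeze_zero_norm' ?_ (tendsto_zero_iff_norm_tendsto_zero.1 hC.leverage)
  filter_upwards [eventually_ge_atTop 1] with n hn
  have h1 : 1 ≤ √(n : ℝ) := Real.one_le_sqrt.2 (by exact_mod_cast hn)
  rw [norm_mul, Real.norm_of_nonneg (Real.sqrt_nonneg _)]
  exact le_mul_of_one_le_left (norm_nonneg _) h1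

/-- Without measurements `H_n = 0`, whose `lambdaMin` is `0` (for `p = 0` because `sInf ∅ = 0`),
against `λ_min(H_n) → ∞`. -/
lemma CondIndep.pos_left (hC : CondIndep μ x B β₀) : 0 < m := by
  rcases Nat.eq_zero_or_pos m with rfl | h
  · exfalso
    obtain ⟨n, hn⟩ := (hC.eigen.eventually_gt_atTop 0).exists
    have hH : HIndep μ x β₀ n = 0 := by
      refine Finset.sum_eq_zero fun i _ => ?_
      ext a b
      simp [Matrix.mul_apply]
    rw [hH, lambdaMin] at hn
    rcases Nat.eq_zero_or_pos p with rfl | hp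
    · rw [spectrum.of_subsingleton, Real.sInf_empty] at hn
      exact lt_irrefl _ hn
    · have : NeZero p := ⟨hp.ne'⟩
      rw [spectrum.zero_eq, csInf_singleton] at hn
      exact lt_irrefl _ hn
  · exact h

/-- On the ellipsoids `vᵀ H_n v ≤ c`, the parameter set is eventually not left. -/
lemma CondIndep.eventually_mem (hC : CondIndep μ x B β₀) (hpos : ∀ t, 0 < deriv μ t)
    (hB : IsOpen B) (h0 : β₀ ∈ B) (c : ℝ) :
    ∀ᶠ n in atTop, ∀ β, quadIndep μ x β₀ n (β - β₀) ≤ c → β ∈ B := by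
  obtain ⟨ρ, hρ, hsub⟩ := Metric.isOpen_iff.1 hB β₀ h0
  filter_upwards [hC.eigen.eventually_gt_atTop (c / ρ ^ 2), hC.eigen.eventually_gt_atTop 0]
    with n hn hn0 β hβ
  refine hsub ?_
  rw [Metric.mem_ball, dist_eq_norm]
  by_contra hcon
  have h1 : ρ ^ 2 ≤ ‖β - β₀‖ ^ 2 := by
    have := not_lt.1 hcon
    gcongr
  have h2 := lambdaMin_mul_norm_sq_le (x := x) (β₀ := β₀) hpos n (β - β₀)
  rw [div_lt_iff₀ (by positivity)] at hn
  have h3 : lambdaMin (HIndep μ x β₀ n) * ρ ^ 2 ≤ lambdaMin (HIndep μ x β₀ n) * ‖β - β₀‖ ^ 2 :=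
    mul_le_mul_of_nonneg_left h1 hn0.le
  linarith

/-- If the logarithmic derivative of `μ'` is bounded by `K` between `a` and `b`, then `log μ'`
is `K`-Lipschitz there. -/
lemma abs_log_deriv_sub_le (hpos : ∀ t, 0 < deriv μ t)
    (hd : Differentiable ℝ (iteratedDeriv 1 μ)) {a b K : ℝ}
    (hK : ∀ u ∈ Set.uIcc a b, |iteratedDeriv 2 μ u / deriv μ u| ≤ K) {u : ℝ}
    (hu : u ∈ Set.uIcc a b) :
    |Real.log (deriv μ u) - Real.log (deriv μ a)| ≤ K * |b - a| := by
  have hK0 : 0 ≤ K := (abs_nonneg _).trans (hK a Set.left_mem_uIcc)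
  have hder : ∀ v, HasDerivAt (fun t => Real.log (deriv μ t))
      (iteratedDeriv 2 μ v / deriv μ v) v := by
    intro v
    have h1 : HasDerivAt (deriv μ) (iteratedDeriv 2 μ v) v := by
      have := (hd v).hasDerivAt
      rwa [← iteratedDeriv_succ, iteratedDeriv_one] at this
    exact h1.log (hpos v).ne'
  have h := (convex_uIcc a b).norm_image_sub_le_of_norm_hasDerivWithin_le
    (fun v _ => (hder v).hasDerivWithinAt) hK Set.left_mem_uIcc hu
  refine h.trans (mul_le_mul_of_nonneg_left ?_ hK0)
  rw [Real.norm_eq_abs]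
  exact Set.abs_sub_left_of_mem_uIcc hu

/-- The variances on the ellipsoids `B_n(r)` are uniformly comparable to those at `β₀`, with a
ratio tending to one. -/
lemma CondIndep.eventually_deriv_le (hC : CondIndep μ x B β₀) (hpos : ∀ t, 0 < deriv μ t)
    (hB : IsOpen B) (h0 : β₀ ∈ B) {r κ : ℝ} (hr : 0 < r) (hκ : 1 < κ) :
    ∀ᶠ n in atTop, ∀ β, quadIndep μ x β₀ n (β - β₀) ≤ m * r ^ 2 → ∀ i < n, ∀ j,
      ∀ u ∈ Set.uIcc (theta x i j β₀) (theta x i j β),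
        deriv μ u ≤ κ * sigmaSq μ x i j β₀ ∧ sigmaSq μ x i j β₀ ≤ κ * deriv μ u := by
  obtain ⟨K, hK⟩ := hC.bounded r hr
  have hlim : Tendsto (fun n => K * √(gammaIndep μ x β₀ n * (m * r ^ 2))) atTop (𝓝 0) := by
    have h1 := (hC.tendsto_gammaIndep.mul_const (m * r ^ 2)).sqrt.const_mul K
    simpa using h1
  filter_upwards [hC.eventually_mem hpos hB h0 (m * r ^ 2), hC.eigen.eventually_gt_atTop 0,
    hlim.eventually_lt_const (Real.log_pos hκ)] with n hmem hlam hsmall β hβ i hi j u hu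
  set v := β - β₀ with hv
  have hQ0 := quadIndep_nonneg (x := x) (β₀ := β₀) hpos n v
  -- The ellipsoid is star-shaped about `β₀`, so each point between the two predictors is the
  -- predictor of some parameter in `B_n(r)`, where the bound `K` applies.
  have hball : ∀ u ∈ Set.uIcc (theta x i j β₀) (theta x i j β),
      |iteratedDeriv 2 μ u / deriv μ u| ≤ K := by
    intro u hu
    rw [← segment_eq_uIcc, segment_eq_image'] at hu
    obtain ⟨s, ⟨hs0, hs1⟩, rfl⟩ := hu
    have hθ : theta x i j β₀ + s • (theta x i j β - theta x i j β₀)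
        = theta x i j (β₀ + s • v) := by
      rw [theta_add_smul, theta_sub, smul_eq_mul]
      rfl
    have hQ : quadIndep μ x β₀ n (β₀ + s • v - β₀) ≤ m * r ^ 2 := by
      rw [add_sub_cancel_left, quadIndep_smul]
      refine le_trans ?_ hβ
      exact mul_le_of_le_one_left hQ0 (pow_le_one₀ hs0 hs1)
    have hin : β₀ + s • v ∈ ballIndep μ x B β₀ n r :=
      (mem_ballIndep_iff hpos hr.le).2 ⟨hmem _ hQ, hQ⟩
    dsimp only
    rw [hθ]
    exact (le_ciSup (f := fun q : Fin n × Fin m =>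
      |iteratedDeriv 2 μ (theta x q.1 q.2 (β₀ + s • v)) / deriv μ (theta x q.1 q.2 (β₀ + s • v))|)
      (Set.finite_range _).bddAbove (⟨i, hi⟩, j)).trans (hK n _ hin).1
  have hK0 : 0 ≤ K := (abs_nonneg _).trans (hball _ Set.left_mem_uIcc)
  have hΔ : |theta x i j β - theta x i j β₀| ≤ √(gammaIndep μ x β₀ n * (m * r ^ 2)) := by
    refine Real.abs_le_sqrt ?_
    rw [theta_sub]
    refine (sq_dotProduct_le_gammaIndep_mul hpos (posDef_HIndep hpos hlam) hi j v).trans ?_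
    refine mul_le_mul_of_nonneg_left hβ ?_
    have hHi : (HIndep μ x β₀ n)⁻¹.PosSemidef := (posDef_HIndep hpos hlam).inv.posSemidef
    exact Real.iSup_nonneg fun q => by
      simpa using hHi.dotProduct_mulVec_nonneg (x q.1 q.2 : Fin p → ℝ)
  have hlog := (abs_log_deriv_sub_le hpos hC.differentiable_two hball hu).trans
    ((mul_le_mul_of_nonneg_left hΔ hK0).trans hsmall.le)
  rw [abs_le] at hlog
  have hσ : 0 < sigmaSq μ x i j β₀ := hpos _
  have hκ0 : 0 < κ := one_pos.trans hκ
  constructor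
  · rw [← Real.log_le_log_iff (hpos u) (by positivity), Real.log_mul hκ0.ne' hσ.ne']
    simp only [sigmaSq]
    linarith
  · rw [← Real.log_le_log_iff hσ (mul_pos hκ0 (hpos u)), Real.log_mul hκ0.ne' (hpos u).ne']
    simp only [sigmaSq]
    linarith

lemma estCorr_apply {Ω : Type*} (y : ℕ → Ω → Fin m → ℝ) (βt : ℕ → Ω → EuclideanSpace ℝ (Fin p))
    (n : ℕ) (ω : Ω) (j k : Fin m) :
    estCorr μ x y βt n ω j k = (n : ℝ)⁻¹ * ∑ i ∈ Finset.range n,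
      ((√(sigmaSq μ x i j (βt n ω)))⁻¹ * resid μ x y i (βt n ω) ω j) *
        ((√(sigmaSq μ x i k (βt n ω)))⁻¹ * resid μ x y i (βt n ω) ω k) := by
  rw [estCorr, Matrix.smul_apply, Matrix.sum_apply, smul_eq_mul, one_div]
  congr 1
  refine Finset.sum_congr rfl fun i _ => ?_
  rw [varMatrixInvSqrt, Matrix.mul_diagonal, Matrix.diagonal_mul, Matrix.vecMulVec_apply]
  ring

lemma ystar_apply {Ω : Type*} (y : ℕ → Ω → Fin m → ℝ) (i : ℕ) (ω : Ω) (j : Fin m) :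
    ystar μ x β₀ y i ω j = (√(sigmaSq μ x i j β₀))⁻¹ * resid μ x y i β₀ ω j := by
  rw [ystar, varMatrixInvSqrt, mulVec_diagonal]

/-- Comparison of products of standardized residuals: the standardization is changed from the mean
`a` and variance `s` to the mean `a'` and variance `s'`. -/
lemma exists_affine_standardized {κ s s' a a' Δ t : ℝ} (hκ1 : 1 ≤ κ) (hκ2 : κ ≤ 2) (hs : 0 < s)
    (hs' : 0 < s') (h1 : s' ≤ κ * s) (h2 : s ≤ κ * s') (hΔ : |a' - a| ≤ κ * s * |Δ|) :
    ∃ c d : ℝ, (√s')⁻¹ * (t - a') = c * ((√s)⁻¹ * (t - a)) + d ∧ 0 ≤ c ∧ c ^ 2 ≤ κ ∧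
      1 ≤ κ * c ^ 2 ∧ d ^ 2 ≤ 8 * (s * Δ ^ 2) := by
  have hr : 0 < √s := Real.sqrt_pos.2 hs
  have hr' : 0 < √s' := Real.sqrt_pos.2 hs'
  refine ⟨√s / √s', (√s')⁻¹ * (a - a'), ?_, by positivity, ?_, ?_, ?_⟩
  · field_simp
    ring
  · rw [div_pow, Real.sq_sqrt hs.le, Real.sq_sqrt hs'.le, div_le_iff₀ hs']
    exact h2
  · rw [div_pow, Real.sq_sqrt hs.le, Real.sq_sqrt hs'.le, ← mul_div_assoc, le_div_iff₀ hs']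
    linarith
  · have h3 : (a - a') ^ 2 ≤ (κ * s * |Δ|) ^ 2 := by
      rw [← sq_abs, abs_sub_comm]
      gcongr
    rw [mul_pow, inv_pow, Real.sq_sqrt hs'.le, inv_mul_le_iff₀ hs']
    refine h3.trans ?_
    have h4 : (κ * s * |Δ|) ^ 2 = κ ^ 2 * s * (s * Δ ^ 2) := by
      rw [mul_pow, sq_abs]
      ring
    -- The constant 8 is an upper bound of `κ³`, since `s ≤ κ s'` and `κ ≤ 2`.
    have h5 : κ ^ 2 * s ≤ 8 * s' := by
      have : κ ^ 2 ≤ 4 := by nlinarith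
      nlinarith
    have h6 : 0 ≤ s * Δ ^ 2 := by positivity
    rw [h4]
    nlinarith [mul_le_mul_of_nonneg_right h5 h6]

/-- The cross terms are split by the weighted inequality `2|Yd| ≤ η Y² + d²/η`. This keeps the
coefficient of `N` small at the price of a large one for `D`, which is harmless because the
`D`-terms are later divided by `n` while their sum stays bounded. -/
lemma abs_mul_sub_mul_le {κ η c c' d d' Y Y' N D : ℝ} (hκ1 : 1 ≤ κ) (hκ2 : κ ≤ 2) (hη : 0 < η)
    (hc0 : 0 ≤ c) (hc1 : c ^ 2 ≤ κ) (hc2 : 1 ≤ κ * c ^ 2) (hc0' : 0 ≤ c') (hc1' : c' ^ 2 ≤ κ)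
    (hc2' : 1 ≤ κ * c' ^ 2) (hY : Y ^ 2 ≤ N) (hY' : Y' ^ 2 ≤ N) (hd : d ^ 2 ≤ D)
    (hd' : d' ^ 2 ≤ D) :
    |(c * Y + d) * (c' * Y' + d') - Y * Y'| ≤ (κ - 1 + 2 * η) * N + (2 / η + 1) * D := by
  have hcc : |c * c' - 1| ≤ κ - 1 := by
    have h1 : c * c' ≤ κ := by nlinarith [sq_nonneg (c - c')]
    have h2 : 1 ≤ κ * (c * c') := by
      have h3 : 1 ≤ (κ * (c * c')) ^ 2 := by nlinarith
      exact (one_le_sq_iff₀ (by positivity)).1 h3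
    rw [abs_le]
    constructor
    -- Here `c c' ≥ 1/κ ≥ 2 - κ`, the last step being `(κ - 1)² ≥ 0`.
    · nlinarith [mul_nonneg hc0 hc0', mul_self_nonneg (κ - 1)]
    · linarith
  have hYY : |Y * Y'| ≤ N := by
    rw [abs_le]
    constructor <;> nlinarith [sq_nonneg (Y - Y'), sq_nonneg (Y + Y')]
  have hdd : |d * d'| ≤ D := by
    rw [abs_le]
    constructor <;> nlinarith [sq_nonneg (d - d'), sq_nonneg (d + d')]
  have hcross : ∀ {c Y d : ℝ}, 0 ≤ c → c ^ 2 ≤ κ → Y ^ 2 ≤ N → d ^ 2 ≤ D →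
      |c * Y * d| ≤ η * N + 1 / η * D := by
    intro c Y d hc0 hc1 hY hd
    have hc : c ≤ 2 := by nlinarith
    have hYd : 2 * |Y * d| ≤ η * Y ^ 2 + 1 / η * d ^ 2 := by
      have h1 : 1 / η * d ^ 2 = η * (d / η) ^ 2 := by field_simp
      have h2 : Y * d = η * (Y * (d / η)) := by field_simp
      rw [h1, h2, abs_mul, abs_of_pos hη, abs_mul, ← sq_abs Y, ← sq_abs (d / η)]
      nlinarith [mul_nonneg hη.le (sq_nonneg (|Y| - |d / η|))]
    have h3 : η * Y ^ 2 ≤ η * N := by gcongr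
    have h4 : 1 / η * d ^ 2 ≤ 1 / η * D := by gcongr
    rw [mul_assoc, abs_mul, abs_of_nonneg hc0]
    nlinarith [mul_le_mul_of_nonneg_right hc (abs_nonneg (Y * d))]
  have e1 := hcross hc0 hc1 hY hd'
  have e2 := hcross hc0' hc1' hY' hd
  have e3 : |(c * c' - 1) * (Y * Y')| ≤ (κ - 1) * N := by
    rw [abs_mul]
    exact mul_le_mul hcc hYY (abs_nonneg _) (by linarith)
  have hexp : (c * Y + d) * (c' * Y' + d') - Y * Y'
      = (c * c' - 1) * (Y * Y') + c * Y * d' + c' * Y' * d + d * d' := by ring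
  rw [hexp]
  have t1 := abs_add_le ((c * c' - 1) * (Y * Y') + c * Y * d' + c' * Y' * d) (d * d')
  have t2 := abs_add_le ((c * c' - 1) * (Y * Y') + c * Y * d') (c' * Y' * d)
  have t3 := abs_add_le ((c * c' - 1) * (Y * Y')) (c * Y * d')
  have e4 : (κ - 1 + 2 * η) * N + (2 / η + 1) * D
      = (κ - 1) * N + (η * N + 1 / η * D) + (η * N + 1 / η * D) + D := by ring
  linarith

/-- The average of the squared norms of the normalized residuals. -/
noncomputable def avgSqNorm {Ω : Type*} (μ : ℝ → ℝ) (x : ℕ → Fin m → EuclideanSpace ℝ (Fin p))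
    (β₀ : EuclideanSpace ℝ (Fin p)) (y : ℕ → Ω → Fin m → ℝ) (n : ℕ) (ω : Ω) : ℝ :=
  (n : ℝ)⁻¹ * ∑ i ∈ Finset.range n, ∑ j, ystar μ x β₀ y i ω j ^ 2

/-- Uniformly over the ellipsoids `B_n(r)`, replacing the true parameter by another one changes
the empirical correlation matrix by little. -/
lemma CondIndep.eventually_abs_estCorr_sub_le {Ω : Type*} (y : ℕ → Ω → Fin m → ℝ)
    (hC : CondIndep μ x B β₀) (hpos : ∀ t, 0 < deriv μ t) (hμ : Differentiable ℝ μ)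
    (hB : IsOpen B) (h0 : β₀ ∈ B) {r ε : ℝ} (hr : 0 < r) (hε : 0 < ε) :
    ∀ᶠ n : ℕ in atTop, ∀ (βt : ℕ → Ω → EuclideanSpace ℝ (Fin p)) (ω : Ω),
      quadIndep μ x β₀ n (βt n ω - β₀) ≤ m * r ^ 2 → ∀ j k,
      |estCorr μ x y βt n ω j k - (n : ℝ)⁻¹ *
        ∑ i ∈ Finset.range n, ystar μ x β₀ y i ω j * ystar μ x β₀ y i ω k| ≤
          ε * (1 + avgSqNorm μ x β₀ y n ω) := by
  -- With `η = ε/4`, the coefficient `κ - 1 + 2η` is at most `ε`; the minimum keeps `κ ≤ 2`.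
  set κ : ℝ := 1 + min (ε / 2) 1 with hκdef
  have hmin : 0 < min (ε / 2) 1 := lt_min (by linarith) one_pos
  have hκ1 : 1 < κ := by linarith
  have hκ2 : κ ≤ 2 := by linarith [min_le_right (ε / 2) 1]
  have hκε : κ - 1 ≤ ε / 2 := by linarith [min_le_left (ε / 2) 1]
  set η : ℝ := ε / 4 with hη
  have hη0 : 0 < η := by positivity
  set A : ℝ := (2 / η + 1) * (8 * (m * r ^ 2)) with hA
  have hlim : Tendsto (fun n : ℕ => (n : ℝ)⁻¹ * A) atTop (𝓝 0) := by
    simpa using (tendsto_inv_atTop_nhds_zero_nat (𝕜 := ℝ)).mul_const A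
  filter_upwards [hC.eventually_deriv_le hpos hB h0 hr hκ1, hlim.eventually_le_const hε]
    with n hratio hn βt ω hβ j k
  set β := βt n ω with hβdef
  rw [estCorr_apply, ← mul_sub, ← Finset.sum_sub_distrib, abs_mul,
    abs_of_nonneg (by positivity : (0 : ℝ) ≤ (n : ℝ)⁻¹)]
  have hterm : ∀ i ∈ Finset.range n,
      |((√(sigmaSq μ x i j β))⁻¹ * resid μ x y i β ω j) *
          ((√(sigmaSq μ x i k β))⁻¹ * resid μ x y i β ω k) -
        ystar μ x β₀ y i ω j * ystar μ x β₀ y i ω k| ≤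
      (κ - 1 + 2 * η) * (∑ l, ystar μ x β₀ y i ω l ^ 2) +
        (2 / η + 1) * (8 * ∑ l, sigmaSq μ x i l β₀ * (x i l ⬝ᵥ (β - β₀)) ^ 2) := by
    intro i hi
    have haff : ∀ l, ∃ c d : ℝ, (√(sigmaSq μ x i l β))⁻¹ * resid μ x y i β ω l
        = c * ystar μ x β₀ y i ω l + d ∧ 0 ≤ c ∧ c ^ 2 ≤ κ ∧ 1 ≤ κ * c ^ 2 ∧
        d ^ 2 ≤ 8 * (sigmaSq μ x i l β₀ * (x i l ⬝ᵥ (β - β₀)) ^ 2) := by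
      intro l
      have hrat := hratio β hβ i (Finset.mem_range.1 hi) l
      rw [ystar_apply]
      refine exists_affine_standardized hκ1.le hκ2 (hpos _) (hpos _)
        (hrat _ Set.right_mem_uIcc).1 (hrat _ Set.right_mem_uIcc).2 ?_
      have hmv := (convex_uIcc (theta x i l β₀) (theta x i l β)).norm_image_sub_le_of_norm_deriv_le
        (fun u _ => hμ u) (fun u hu => by
          rw [Real.norm_of_nonneg (hpos u).le]
          exact (hrat u hu).1) Set.left_mem_uIcc Set.right_mem_uIcc
      rwa [Real.norm_eq_abs, Real.norm_eq_abs, theta_sub] at hmv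
    obtain ⟨c, d, e1, e2, e3, e4, e5⟩ := haff j
    obtain ⟨c', d', e1', e2', e3', e4', e5'⟩ := haff k
    rw [e1, e1']
    have hD : ∀ l, 8 * (sigmaSq μ x i l β₀ * (x i l ⬝ᵥ (β - β₀)) ^ 2) ≤
        8 * ∑ l, sigmaSq μ x i l β₀ * (x i l ⬝ᵥ (β - β₀)) ^ 2 := fun l =>
      mul_le_mul_of_nonneg_left (Finset.single_le_sum
        (f := fun l => sigmaSq μ x i l β₀ * (x i l ⬝ᵥ (β - β₀)) ^ 2)
        (fun l _ => mul_nonneg (hpos _).le (sq_nonneg _)) (Finset.mem_univ l)) (by norm_num)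
    have hN : ∀ l, ystar μ x β₀ y i ω l ^ 2 ≤ ∑ l, ystar μ x β₀ y i ω l ^ 2 := fun l =>
      Finset.single_le_sum (f := fun l => ystar μ x β₀ y i ω l ^ 2)
        (fun l _ => sq_nonneg _) (Finset.mem_univ l)
    exact abs_mul_sub_mul_le hκ1.le hκ2 hη0 e2 e3 e4 e2' e3' e4' (hN j) (hN k)
      (e5.trans (hD j)) (e5'.trans (hD k))
  have hS0 : 0 ≤ avgSqNorm μ x β₀ y n ω := by
    unfold avgSqNorm
    positivity
  calc (n : ℝ)⁻¹ * |∑ i ∈ Finset.range n,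
        (((√(sigmaSq μ x i j β))⁻¹ * resid μ x y i β ω j) *
          ((√(sigmaSq μ x i k β))⁻¹ * resid μ x y i β ω k) -
        ystar μ x β₀ y i ω j * ystar μ x β₀ y i ω k)|
      ≤ (n : ℝ)⁻¹ * ∑ i ∈ Finset.range n,
        ((κ - 1 + 2 * η) * (∑ l, ystar μ x β₀ y i ω l ^ 2) +
        (2 / η + 1) * (8 * ∑ l, sigmaSq μ x i l β₀ * (x i l ⬝ᵥ (β - β₀)) ^ 2)) := by
        refine mul_le_mul_of_nonneg_left ?_ (by positivity)
        exact (Finset.abs_sum_le_sum_abs _ _).trans (Finset.sum_le_sum hterm)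
    _ = (κ - 1 + 2 * η) * avgSqNorm μ x β₀ y n ω +
        (n : ℝ)⁻¹ * ((2 / η + 1) * (8 * quadIndep μ x β₀ n (β - β₀))) := by
        rw [Finset.sum_add_distrib, ← Finset.mul_sum, ← Finset.mul_sum, ← Finset.mul_sum,
          avgSqNorm, quadIndep]
        simp only [WithLp.ofLp_sub]
        ring
    _ ≤ ε * avgSqNorm μ x β₀ y n ω + (n : ℝ)⁻¹ * A := by
        refine add_le_add (mul_le_mul_of_nonneg_right (by linarith) hS0) ?_
        rw [hA]
        gcongr
    _ ≤ _ := by linarith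

/-- For fixed `n` and subject `i < n`, the standardization factors and the means are bounded over
the ellipsoid `B_n(r)`, even if `H_n` is singular. -/
lemma exists_bound_of_quadIndep_le (hpos : ∀ t, 0 < deriv μ t) (hμ : ContDiff ℝ 1 μ) {n i : ℕ}
    (hi : i < n) (j : Fin m) (c : ℝ) :
    ∃ K : ℝ, ∀ β, quadIndep μ x β₀ n (β - β₀) ≤ c →
      |(√(sigmaSq μ x i j β))⁻¹| ≤ K ∧ |μ (theta x i j β)| ≤ K := by
  -- A single term of the quadratic form confines the predictor to a compact interval of this
  -- half-length, on which continuity gives the bounds.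
  set s := √(c / sigmaSq μ x i j β₀) with hs
  set I := Set.Icc (theta x i j β₀ - s) (theta x i j β₀ + s) with hI
  have hcont : Continuous fun t => (√(deriv μ t))⁻¹ :=
    ((hμ.continuous_deriv_one).sqrt).inv₀ fun t => (Real.sqrt_pos.2 (hpos t)).ne'
  obtain ⟨K₁, hK₁⟩ := isCompact_Icc.exists_bound_of_continuousOn (s := I) hcont.continuousOn
  obtain ⟨K₂, hK₂⟩ := isCompact_Icc.exists_bound_of_continuousOn (s := I)
    hμ.continuous.continuousOn
  refine ⟨max K₁ K₂, fun β hβ => ?_⟩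
  have hσ : 0 < sigmaSq μ x i j β₀ := hpos _
  have hmem : theta x i j β ∈ I := by
    have h1 : |theta x i j β - theta x i j β₀| ≤ s := by
      refine Real.abs_le_sqrt ?_
      rw [theta_sub, le_div_iff₀' hσ]
      exact (sigmaSq_mul_sq_le_quadIndep hpos hi j _).trans hβ
    rw [abs_le] at h1
    exact ⟨by linarith, by linarith⟩
  exact ⟨(hK₁ _ hmem).trans (le_max_left _ _), (hK₂ _ hmem).trans (le_max_right _ _)⟩

end LocalBehaviour

/-! ### Monotonicity of the estimating function. -/

section Score

variable {m p : ℕ} {Ω : Type*} {μ : ℝ → ℝ} {x : ℕ → Fin m → EuclideanSpace ℝ (Fin p)}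
  {β₀ : EuclideanSpace ℝ (Fin p)} {y : ℕ → Ω → Fin m → ℝ}

lemma dotProduct_gIndep (n : ℕ) (β : EuclideanSpace ℝ (Fin p)) (ω : Ω) (u : Fin p → ℝ) :
    u ⬝ᵥ gIndep μ x y n β ω =
      ∑ i ∈ Finset.range n, ∑ j, (x i j ⬝ᵥ u) * resid μ x y i β ω j := by
  rw [gIndep, dotProduct_sum]
  refine Finset.sum_congr rfl fun i _ => ?_
  rw [dotProduct_mulVec, vecMul_transpose]
  rfl

/-- Strong monotonicity of the link along a ray, from a lower bound of its derivative near the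
starting point. -/
lemma mul_sq_le_mul_sub (hpos : ∀ t, 0 < deriv μ t) (hμ : Differentiable ℝ μ) {θ Δ t s : ℝ}
    (ht0 : 0 ≤ t) (ht1 : t ≤ 1) (hs : ∀ u ∈ Set.uIcc θ (θ + t * Δ), s ≤ 2 * deriv μ u) :
    t / 2 * (s * Δ ^ 2) ≤ Δ * (μ (θ + Δ) - μ θ) := by
  -- The derivative bound is used only on the initial fraction `t` of the segment; on the rest,
  -- monotonicity of `μ` suffices.
  have hmono : Monotone μ := (strictMono_of_deriv_pos hpos).monotone
  have hlin : ∀ a b, a ≤ b → Set.Icc a b ⊆ Set.uIcc θ (θ + t * Δ) →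
      s / 2 * (b - a) ≤ μ b - μ a := by
    intro a b hab hsub
    refine (convex_Icc a b).mul_sub_le_image_sub_of_le_deriv hμ.continuous.continuousOn
      hμ.differentiableOn (fun u hu => ?_) a (Set.left_mem_Icc.2 hab) b (Set.right_mem_Icc.2 hab)
      hab
    have := hs u (hsub (interior_subset hu))
    linarith
  rcases le_total 0 Δ with hΔ | hΔ
  · have h1 : 0 ≤ t * Δ := mul_nonneg ht0 hΔ
    have h2 := hlin θ (θ + t * Δ) (by linarith) (by rw [Set.uIcc_of_le (by linarith)])
    have h3 : μ (θ + t * Δ) ≤ μ (θ + Δ) := hmono (by nlinarith)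
    have h4 : s / 2 * (t * Δ) ≤ μ (θ + Δ) - μ θ := by
      rw [add_sub_cancel_left] at h2
      linarith
    nlinarith [mul_le_mul_of_nonneg_left h4 hΔ]
  · have h1 : t * Δ ≤ 0 := mul_nonpos_of_nonneg_of_nonpos ht0 hΔ
    have h2 := hlin (θ + t * Δ) θ (by linarith) (by rw [Set.uIcc_of_ge (by linarith)])
    have h3 : μ (θ + Δ) ≤ μ (θ + t * Δ) := hmono (by nlinarith)
    have h4 : s / 2 * (-(t * Δ)) ≤ μ θ - μ (θ + Δ) := by
      have : θ - (θ + t * Δ) = -(t * Δ) := by ring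
      rw [this] at h2
      linarith
    nlinarith [mul_le_mul_of_nonneg_left h4 (neg_nonneg.2 hΔ)]

/-- A root of the estimating function outside the ellipsoid `B_n(r)` forces the score at `β₀` to
be large. -/
lemma le_sum_sq_of_gIndep_eq_zero (hpos : ∀ t, 0 < deriv μ t) (hμ : Differentiable ℝ μ) {n : ℕ}
    {c : ℝ} (hc : 0 < c)
    (hratio : ∀ β, quadIndep μ x β₀ n (β - β₀) ≤ c → ∀ i < n, ∀ j,
      ∀ u ∈ Set.uIcc (theta x i j β₀) (theta x i j β), sigmaSq μ x i j β₀ ≤ 2 * deriv μ u)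
    {u : Fin p → EuclideanSpace ℝ (Fin p)}
    (hu : ∀ (v : EuclideanSpace ℝ (Fin p)) (g : Fin p → ℝ),
        (v ⬝ᵥ g) ^ 2 ≤ quadIndep μ x β₀ n v * ∑ k, (u k ⬝ᵥ g) ^ 2)
    {β : EuclideanSpace ℝ (Fin p)} {ω : Ω} (hroot : gIndep μ x y n β ω = 0)
    (hβ : c < quadIndep μ x β₀ n (β - β₀)) :
    c / 4 ≤ ∑ k, (u k ⬝ᵥ gIndep μ x y n β₀ ω) ^ 2 := by
  set v := β - β₀ with hv
  set Q := quadIndep μ x β₀ n v with hQ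
  set G := ∑ k, (u k ⬝ᵥ gIndep μ x y n β₀ ω) ^ 2 with hG
  have hQ0 : 0 < Q := hc.trans hβ
  -- The factor that shrinks `v` to the boundary of the ellipsoid, where the quadratic form equals
  -- `c`.
  set t := √(c / Q) with ht
  have ht2 : t ^ 2 = c / Q := Real.sq_sqrt (by positivity)
  have ht0 : 0 ≤ t := Real.sqrt_nonneg _
  have ht1 : t ≤ 1 := Real.sqrt_le_one.2 ((div_le_one hQ0).2 hβ.le)
  have hin : quadIndep μ x β₀ n (β₀ + t • v - β₀) ≤ c := by
    rw [add_sub_cancel_left, quadIndep_smul, ht2, ← hQ]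
    exact (div_mul_cancel₀ c hQ0.ne').le
  -- As `g_n(β) = 0`, the left factor `v` is paired with `g_n(β₀) - g_n(β)`, from which the
  -- responses cancel. Squaring and Cauchy–Schwarz give `t² Q² / 4 ≤ Q G`, where `t² Q = c`.
  have hscore : t / 2 * Q ≤ v ⬝ᵥ gIndep μ x y n β₀ ω := by
    have h1 : v ⬝ᵥ gIndep μ x y n β₀ ω = ∑ i ∈ Finset.range n, ∑ j,
        (x i j ⬝ᵥ v) * (μ (theta x i j β₀ + x i j ⬝ᵥ v) - μ (theta x i j β₀)) := by
      have h2 : v ⬝ᵥ gIndep μ x y n β₀ ω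
          = v ⬝ᵥ gIndep μ x y n β₀ ω - v ⬝ᵥ gIndep μ x y n β ω := by
        rw [hroot, dotProduct_zero, sub_zero]
      rw [h2, dotProduct_gIndep, dotProduct_gIndep, ← Finset.sum_sub_distrib]
      refine Finset.sum_congr rfl fun i _ => ?_
      rw [← Finset.sum_sub_distrib]
      refine Finset.sum_congr rfl fun j _ => ?_
      have h3 : theta x i j β₀ + x i j ⬝ᵥ v = theta x i j β := by
        have := theta_sub (x := x) i j β β₀
        rw [hv, WithLp.ofLp_sub]
        linarith
      rw [h3, resid, resid]
      ring
    rw [h1, hQ, quadIndep, Finset.mul_sum]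
    refine Finset.sum_le_sum fun i hi => ?_
    rw [Finset.mul_sum]
    refine Finset.sum_le_sum fun j _ => ?_
    refine mul_sq_le_mul_sub hpos hμ ht0 ht1 fun w hw => ?_
    refine hratio _ hin i (Finset.mem_range.1 hi) j w ?_
    rwa [theta_add_smul]
  have hcs := hu v (gIndep μ x y n β₀ ω)
  have h4 : (t / 2 * Q) ^ 2 ≤ Q * G :=
    (pow_le_pow_left₀ (by positivity) hscore 2).trans hcs
  have h5 : (t / 2 * Q) ^ 2 = Q * (c / 4) := by
    rw [mul_pow, div_pow, ht2]
    field_simp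
    norm_num
  rw [h5] at h4
  exact le_of_mul_le_mul_left h4 hQ0

end Score

/-! ### Moments of the residuals and of the score; localization of the roots. -/

section Model

variable {m p : ℕ} {Ω : Type*} [MeasurableSpace Ω] {P : Measure Ω} {μ : ℝ → ℝ}
  {x : ℕ → Fin m → EuclideanSpace ℝ (Fin p)} {B : Set (EuclideanSpace ℝ (Fin p))}
  {β₀ : EuclideanSpace ℝ (Fin p)} {y : ℕ → Ω → Fin m → ℝ}

lemma IsModel.differentiable_link (h : IsModel P μ x B β₀ y) : Differentiable ℝ μ :=
  h.link_contDiff.differentiable one_ne_zero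

lemma IsModel.measurable_resid (h : IsModel P μ x B β₀ y) (i : ℕ)
    (β : EuclideanSpace ℝ (Fin p)) : Measurable fun ω => resid μ x y i β ω := by
  refine measurable_pi_lambda _ fun j => ?_
  exact ((measurable_pi_apply j).comp (h.measurable_obs i)).sub_const _

/-- The filtration generated by the residuals. -/
def IsModel.filtration (h : IsModel P μ x B β₀ y) : Filtration ℕ ‹MeasurableSpace Ω› where
  seq i := past μ x β₀ y i
  mono' _ _ hij := iSup_le fun k => le_iSup_of_le (Fin.castLE hij k) le_rfl
  le' _ := iSup_le fun k => (h.measurable_resid k β₀).comap_le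

/-- Index shift: subjects start at `0` and stage `i` of the filtration contains only the subjects
before `i`, so subject `i` enters at stage `i + 1`. -/
lemma IsModel.measurable_resid_filtration (h : IsModel P μ x B β₀ y) (i : ℕ) :
    Measurable[h.filtration (i + 1)] fun ω => resid μ x y i β₀ ω := by
  have hle : MeasurableSpace.comap (fun ω => resid μ x y i β₀ ω) inferInstance ≤
      h.filtration (i + 1) :=
    le_iSup_of_le (f := fun k : Fin (i + 1) =>
      MeasurableSpace.comap (fun ω => resid μ x y k β₀ ω) inferInstance) (Fin.last i) le_rfl
  exact (comap_measurable _).mono hle le_rfl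

lemma IsModel.measurable_resid_filtration_apply (h : IsModel P μ x B β₀ y) (i : ℕ) (j : Fin m) :
    Measurable[h.filtration (i + 1)] fun ω => resid μ x y i β₀ ω j :=
  (measurable_pi_apply j).comp (h.measurable_resid_filtration i)

lemma IsModel.integral_resid_sq (h : IsModel P μ x B β₀ y) (i : ℕ) (j : Fin m) :
    ∫ ω, resid μ x y i β₀ ω j ^ 2 ∂P = sigmaSq μ x i j β₀ := by
  rw [← h.variance_eq, variance_eq_integral (h.sq_integrable i j).aemeasurable, h.mean_eq]
  rfl

lemma IsModel.measurable_ystar_filtration (h : IsModel P μ x B β₀ y) (i : ℕ) (j : Fin m) :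
    Measurable[h.filtration (i + 1)] fun ω => ystar μ x β₀ y i ω j := by
  simp only [ystar_apply]
  exact (h.measurable_resid_filtration_apply i j).const_mul _

lemma IsModel.integral_ystar_mul (h : IsModel P μ x B β₀ y) (i : ℕ) (j k : Fin m) :
    ∫ ω, ystar μ x β₀ y i ω j * ystar μ x β₀ y i ω k ∂P = trueCorr P y i j k := by
  have h1 : ∀ ω, ystar μ x β₀ y i ω j * ystar μ x β₀ y i ω k =
      ((√(sigmaSq μ x i j β₀))⁻¹ * (√(sigmaSq μ x i k β₀))⁻¹) *
        (resid μ x y i β₀ ω j * resid μ x y i β₀ ω k) := fun ω => by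
    rw [ystar_apply, ystar_apply]
    ring
  simp only [h1]
  rw [integral_const_mul, trueCorr, Matrix.of_apply, covariance, h.variance_eq, h.variance_eq,
    h.mean_eq, h.mean_eq, div_eq_inv_mul, mul_inv]
  rfl

lemma IsModel.trueCorr_self (h : IsModel P μ x B β₀ y) (i : ℕ) (j : Fin m) :
    trueCorr P y i j j = 1 := by
  have hσ : 0 < sigmaSq μ x i j β₀ := h.link_deriv_pos _
  rw [trueCorr, Matrix.of_apply, covariance_self (h.sq_integrable i j).aemeasurable,
    h.variance_eq, Real.mul_self_sqrt hσ.le, div_self hσ.ne']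

variable [IsProbabilityMeasure P]

lemma IsModel.memLp_resid (h : IsModel P μ x B β₀ y) (i : ℕ) (β : EuclideanSpace ℝ (Fin p))
    (j : Fin m) : MemLp (fun ω => resid μ x y i β ω j) 2 P :=
  (h.sq_integrable i j).sub (memLp_const _)

lemma IsModel.memLp_ystar (h : IsModel P μ x B β₀ y) (i : ℕ) (j : Fin m) :
    MemLp (fun ω => ystar μ x β₀ y i ω j) 2 P := by
  simp only [ystar_apply]
  exact (h.memLp_resid i β₀ j).const_mul _

lemma IsModel.integrable_ystar_mul (h : IsModel P μ x B β₀ y) (i : ℕ) (j k : Fin m) :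
    Integrable (fun ω => ystar μ x β₀ y i ω j * ystar μ x β₀ y i ω k) P :=
  (h.memLp_ystar i j).integrable_mul (h.memLp_ystar i k)

lemma IsModel.integrable_avgSqNorm (h : IsModel P μ x B β₀ y) (n : ℕ) :
    Integrable (avgSqNorm μ x β₀ y n) P :=
  (integrable_finsetSum _ fun i _ => integrable_finsetSum _ fun j _ =>
    (h.memLp_ystar i j).integrable_sq).const_mul _

/-- Each component of `y_i^*` has second moment one. Equality fails only at `n = 0`, where the
inverse is `0`. -/
lemma IsModel.integral_avgSqNorm_le (h : IsModel P μ x B β₀ y) (n : ℕ) :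
    ∫ ω, avgSqNorm μ x β₀ y n ω ∂P ≤ m := by
  have h1 : ∫ ω, avgSqNorm μ x β₀ y n ω ∂P = (n : ℝ)⁻¹ * (n * m) := by
    simp only [avgSqNorm]
    rw [integral_const_mul, integral_finsetSum _ fun i _ => integrable_finsetSum _ fun j _ =>
      (h.memLp_ystar i j).integrable_sq]
    congr 1
    have h2 : ∀ i, ∫ ω, ∑ j, ystar μ x β₀ y i ω j ^ 2 ∂P = m := by
      intro i
      rw [integral_finsetSum _ fun j _ => (h.memLp_ystar i j).integrable_sq]
      simp only [sq, h.integral_ystar_mul, h.trueCorr_self]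
      simp
    simp [h2]
  rw [h1, ← mul_assoc]
  exact mul_le_of_le_one_left (Nat.cast_nonneg m) inv_mul_le_one

lemma IsModel.memLp_dotProduct_gIndep (h : IsModel P μ x B β₀ y) (n : ℕ) (u : Fin p → ℝ) :
    MemLp (fun ω => u ⬝ᵥ gIndep μ x y n β₀ ω) 2 P := by
  simp only [dotProduct_gIndep]
  exact memLp_finsetSum _ fun i _ => memLp_finsetSum _ fun j _ =>
    (h.memLp_resid i β₀ j).const_mul _

/-- The variance of `uᵀ g_n` is at most `m uᵀ H_n u`. -/
lemma IsModel.integral_dotProduct_gIndep_sq_le (h : IsModel P μ x B β₀ y) (n : ℕ)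
    (u : EuclideanSpace ℝ (Fin p)) :
    ∫ ω, (u ⬝ᵥ gIndep μ x y n β₀ ω) ^ 2 ∂P ≤ m * quadIndep μ x β₀ n u := by
  simp only [dotProduct_gIndep]
  set e : ℕ → Ω → ℝ := fun i ω => ∑ j, (x i j ⬝ᵥ u) * resid μ x y i β₀ ω j with he
  have he2 : ∀ i, MemLp (e i) 2 P := fun i => memLp_finsetSum _ fun j _ =>
    (h.memLp_resid i β₀ j).const_mul _
  have hem : ∀ i, StronglyMeasurable[h.filtration (i + 1)] (e i) := fun i =>
    Finset.stronglyMeasurable_fun_sum _ fun j _ =>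
      (h.measurable_resid_filtration_apply i j).stronglyMeasurable.const_mul _
  have he0 : ∀ i, P[e i | h.filtration i] =ᵐ[P] 0 := by
    intro i
    have hsum : e i = ∑ j, (x i j ⬝ᵥ u) • fun ω => resid μ x y i β₀ ω j := by
      ext ω
      simp [he]
    rw [hsum]
    refine (condExp_finsetSum (fun j _ =>
      ((h.memLp_resid i β₀ j).integrable one_le_two).smul _) _).trans ?_
    have hz : ∀ᵐ ω ∂P, ∀ j, (P[(x i j ⬝ᵥ u) • fun ω => resid μ x y i β₀ ω j |
        h.filtration i]) ω = 0 := by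
      rw [ae_all_iff]
      intro j
      filter_upwards [condExp_smul (μ := P) (x i j ⬝ᵥ u) (fun ω => resid μ x y i β₀ ω j)
        (h.filtration i), h.martingale_diff i j] with ω h1 h2
      rw [h1, Pi.smul_apply]
      change (x i j ⬝ᵥ u) • (P[fun ω => resid μ x y i β₀ ω j | past μ x β₀ y i]) ω = 0
      rw [h2]
      simp
    filter_upwards [hz] with ω hω
    simp [Finset.sum_apply, hω]
  rw [integral_sq_sum_of_condExp_eq_zero h.filtration hem he2 he0, quadIndep, Finset.mul_sum]
  refine Finset.sum_le_sum fun i _ => ?_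
  have hterm : ∀ j, Integrable (fun ω => ((x i j ⬝ᵥ u) * resid μ x y i β₀ ω j) ^ 2) P := fun j =>
    ((h.memLp_resid i β₀ j).const_mul _).integrable_sq
  -- Correlations within a subject are arbitrary, so the `m` components are separated by
  -- Cauchy–Schwarz; this costs the factor `m`.
  calc ∫ ω, e i ω ^ 2 ∂P ≤ ∫ ω, m * ∑ j, ((x i j ⬝ᵥ u) * resid μ x y i β₀ ω j) ^ 2 ∂P := by
        refine integral_mono (he2 i).integrable_sq
          ((integrable_finsetSum _ fun j _ => hterm j).const_mul _) fun ω => ?_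
        have := sq_sum_le_card_mul_sum_sq (s := Finset.univ)
          (f := fun j => (x i j ⬝ᵥ u) * resid μ x y i β₀ ω j)
        simpa [he] using this
    _ = m * ∑ j, sigmaSq μ x i j β₀ * (x i j ⬝ᵥ u) ^ 2 := by
        rw [integral_const_mul, integral_finsetSum _ fun j _ => hterm j]
        congr 1
        refine Finset.sum_congr rfl fun j _ => ?_
        simp only [mul_pow]
        rw [integral_const_mul, h.integral_resid_sq, mul_comm]

/-- The working-independence estimators are eventually in an ellipsoid `B_n(r)` with high
probability. -/
lemma IsPrelim.exists_radius {b : ℕ → Ω → EuclideanSpace ℝ (Fin p)}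
    (hb : IsPrelim P μ x B β₀ y b) (h : IsModel P μ x B β₀ y) (hC : CondIndep μ x B β₀) {ε : ℝ}
    (hε : 0 < ε) :
    ∃ r : ℝ, 0 < r ∧ ∃ N : ℕ, ∀ n ≥ N,
      1 - ε ≤ P.real {ω | b n ω ∈ ballIndep μ x B β₀ n r} := by
  have hpos := h.link_deriv_pos
  have hm : (0 : ℝ) < m := by exact_mod_cast hC.pos_left
  -- Markov's inequality with mean at most `m p` and threshold `m r² / 4` leaves probability `4p /
  -- r² ≤ ε / 2`. The `+ 1` makes `r` positive.
  set r : ℝ := √(8 * p / ε) + 1 with hr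
  have hr0 : 0 < r := by positivity
  have hr2 : 8 * p ≤ ε * r ^ 2 := by
    have h1 : 8 * p / ε ≤ r ^ 2 := by
      rw [← Real.sqrt_le_left hr0.le]
      linarith
    rwa [div_le_iff₀' hε] at h1
  refine ⟨r, hr0, eventually_atTop.1 ?_⟩
  have hroot : ∀ᶠ n in atTop, 1 - ε / 2 < P.real {ω | gIndep μ x y n (b n ω) ω = 0} := by
    have := (ENNReal.tendsto_toReal ENNReal.one_ne_top).comp hb.root
    rw [ENNReal.toReal_one] at this
    exact this.eventually_const_lt (by linarith)
  filter_upwards [hroot, hC.eigen.eventually_gt_atTop 0,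
    hC.eventually_deriv_le hpos h.isOpen_param h.true_mem hr0 one_lt_two] with n hn hlam hratio
  obtain ⟨u, hu1, hu2⟩ := exists_quadIndep_orthonormal hpos (posDef_HIndep hpos hlam)
  set G : Ω → ℝ := fun ω => ∑ k, (u k ⬝ᵥ gIndep μ x y n β₀ ω) ^ 2 with hG
  have hGi : Integrable G P := integrable_finsetSum _ fun k _ =>
    (h.memLp_dotProduct_gIndep n (u k)).integrable_sq
  have hEG : ∫ ω, G ω ∂P ≤ m * p := by
    rw [hG, integral_finsetSum _ fun k _ => (h.memLp_dotProduct_gIndep n (u k)).integrable_sq]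
    refine (Finset.sum_le_sum fun k _ => h.integral_dotProduct_gIndep_sq_le n (u k)).trans ?_
    simp [hu1, mul_comm]
  have hcheb := mul_meas_ge_le_integral_of_nonneg (μ := P) (f := G)
    (Eventually.of_forall fun ω => Finset.sum_nonneg fun k _ => sq_nonneg _) hGi (m * r ^ 2 / 4)
  have hGsmall : P.real {ω | m * r ^ 2 / 4 ≤ G ω} ≤ ε / 2 := by
    have h1 : m * r ^ 2 / 4 * P.real {ω | m * r ^ 2 / 4 ≤ G ω} ≤ m * r ^ 2 / 4 * (ε / 2) := by
      refine hcheb.trans (hEG.trans ?_)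
      nlinarith [mul_le_mul_of_nonneg_left hr2 hm.le]
    exact le_of_mul_le_mul_left h1 (by positivity)
  have hcover : {ω | gIndep μ x y n (b n ω) ω = 0} ⊆
      {ω | b n ω ∈ ballIndep μ x B β₀ n r} ∪ {ω | m * r ^ 2 / 4 ≤ G ω} := by
    intro ω hω
    by_cases hin : b n ω ∈ ballIndep μ x B β₀ n r
    · exact Or.inl hin
    · right
      rw [mem_ballIndep_iff hpos hr0.le] at hin
      have hout : m * r ^ 2 < quadIndep μ x β₀ n (b n ω - β₀) := by
        by_contra hcon
        exact hin ⟨hb.mem n ω, not_lt.1 hcon⟩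
      exact le_sum_sq_of_gIndep_eq_zero hpos h.differentiable_link (by positivity)
        (fun β hβ i hi j w hw => (hratio β hβ i hi j w hw).2) hu2 hω hout
  have := (measureReal_mono (μ := P) hcover).trans (measureReal_union_le _ _)
  linarith

end Model

/-! ### Consistency of the estimated average correlation matrix. -/

section Consistency

variable {m p : ℕ} {Ω : Type*} [MeasurableSpace Ω] {P : Measure Ω}
  {μ : ℝ → ℝ} {x : ℕ → Fin m → EuclideanSpace ℝ (Fin p)} {B : Set (EuclideanSpace ℝ (Fin p))}
  {β₀ : EuclideanSpace ℝ (Fin p)} {y : ℕ → Ω → Fin m → ℝ}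

/-- The empirical correlation matrix at the true parameter is the sum of the average of martingale
differences, of the average deviation of the conditional covariances, and of the average true
correlation matrix. -/
lemma average_ystar_mul_eq (n : ℕ) (ω : Ω) (j k : Fin m) :
    (n : ℝ)⁻¹ * ∑ i ∈ Finset.range n, ystar μ x β₀ y i ω j * ystar μ x β₀ y i ω k =
      (n : ℝ)⁻¹ * ∑ i ∈ Finset.range n, (ystar μ x β₀ y i ω j * ystar μ x β₀ y i ω k -
        (P[fun ω' => ystar μ x β₀ y i ω' j * ystar μ x β₀ y i ω' k | past μ x β₀ y i]) ω) +
      avgCondCovDev P μ x β₀ y n ω j k + avgTrueCorr P y n j k := by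
  simp only [avgCondCovDev, avgTrueCorr, Matrix.smul_apply, Matrix.sum_apply, smul_eq_mul, one_div,
    condCovDev, Matrix.of_apply]
  rw [← mul_add, ← mul_add, ← Finset.sum_add_distrib, ← Finset.sum_add_distrib]
  congr 1
  exact Finset.sum_congr rfl fun i _ => by ring

lemma tendsto_eLpNorm_one_iff {f : ℕ → Ω → ℝ} (hf : ∀ n, Integrable (f n) P) :
    Tendsto (fun n => eLpNorm (f n) 1 P) atTop (𝓝 0) ↔
      Tendsto (fun n => ∫ ω, |f n ω| ∂P) atTop (𝓝 0) := by
  have h1 : ∀ n, eLpNorm (f n) 1 P = ENNReal.ofReal (∫ ω, |f n ω| ∂P) := fun n => by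
    rw [eLpNorm_one_eq_lintegral_enorm, ← ofReal_integral_norm_eq_lintegral_enorm (hf n)]
    rfl
  simp only [h1]
  constructor
  · intro h
    have h2 := (ENNReal.tendsto_toReal ENNReal.zero_ne_top).comp h
    refine h2.congr fun n => ?_
    exact ENNReal.toReal_ofReal (integral_nonneg fun ω => abs_nonneg _)
  · intro h
    simpa using ENNReal.tendsto_ofReal h

variable [IsProbabilityMeasure P]

/-- Condition (C1) bounds the `q`-th moments of the products of the normalized residuals, for some
`1 < q ≤ 2`. -/
lemma CondC1.exists_moment (hC1 : CondC1 P μ x β₀ y) (h : IsModel P μ x B β₀ y) :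
    ∃ q C : ℝ, 1 < q ∧ q ≤ 2 ∧ ∀ i j k,
      MemLp (fun ω => ystar μ x β₀ y i ω j * ystar μ x β₀ y i ω k) (ENNReal.ofReal q) P ∧
      ∫ ω, |ystar μ x β₀ y i ω j * ystar μ x β₀ y i ω k| ^ q ∂P ≤ C := by
  obtain ⟨δ, hδ0, hδ2, hfin⟩ := hC1
  set K := ⨆ i : ℕ, ∫⁻ ω, ‖WithLp.toLp 2 (ystar μ x β₀ y i ω)‖ₑ ^ (2 + δ) ∂P with hK
  have hq0 : 0 < 1 + δ / 2 := by linarith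
  refine ⟨1 + δ / 2, K.toReal, by linarith, by linarith, fun i j k => ?_⟩
  set z : Ω → ℝ := fun ω => ystar μ x β₀ y i ω j * ystar μ x β₀ y i ω k with hz
  have hzm : AEStronglyMeasurable z P := (h.integrable_ystar_mul i j k).aestronglyMeasurable
  have hpt : ∀ ω, ‖z ω‖ₑ ^ (1 + δ / 2) ≤
      ‖WithLp.toLp 2 (ystar μ x β₀ y i ω)‖ₑ ^ (2 + δ) := by
    intro ω
    have h1 : ∀ l, ‖ystar μ x β₀ y i ω l‖ₑ ≤ ‖WithLp.toLp 2 (ystar μ x β₀ y i ω)‖ₑ := fun l =>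
      by
      rw [← ofReal_norm, ← ofReal_norm]
      exact ENNReal.ofReal_le_ofReal (PiLp.norm_apply_le (WithLp.toLp 2 (ystar μ x β₀ y i ω)) l)
    calc ‖z ω‖ₑ ^ (1 + δ / 2)
        ≤ (‖WithLp.toLp 2 (ystar μ x β₀ y i ω)‖ₑ ^ (2 : ℝ)) ^ (1 + δ / 2) := by
          refine ENNReal.rpow_le_rpow ?_ hq0.le
          rw [hz, enorm_mul, ENNReal.rpow_two, sq]
          exact mul_le_mul' (h1 j) (h1 k)
      _ = _ := by
          rw [← ENNReal.rpow_mul]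
          ring_nf
  have hlin : ∫⁻ ω, ‖z ω‖ₑ ^ (1 + δ / 2) ∂P ≤ K :=
    (lintegral_mono hpt).trans (le_iSup (fun i : ℕ =>
      ∫⁻ ω, ‖WithLp.toLp 2 (ystar μ x β₀ y i ω)‖ₑ ^ (2 + δ) ∂P) i)
  have hmem : MemLp z (ENNReal.ofReal (1 + δ / 2)) P := by
    refine ⟨hzm, ?_⟩
    rw [eLpNorm_lt_top_iff_lintegral_rpow_enorm_lt_top (by simpa using hq0) ENNReal.ofReal_ne_top,
      ENNReal.toReal_ofReal hq0.le]
    exact hlin.trans_lt hfin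
  refine ⟨hmem, ?_⟩
  have hint : Integrable (fun ω => |z ω| ^ (1 + δ / 2)) P := by
    have := hmem.integrable_norm_rpow (by simpa using hq0) ENNReal.ofReal_ne_top
    simpa [ENNReal.toReal_ofReal hq0.le] using this
  rw [integral_eq_lintegral_of_nonneg_ae (Eventually.of_forall fun ω => by positivity)
    hint.aestronglyMeasurable]
  refine ENNReal.toReal_mono hfin.ne ((lintegral_mono fun ω => ?_).trans hlin)
  rw [← Real.enorm_eq_ofReal (by positivity), Real.enorm_rpow_of_nonneg (abs_nonneg _) hq0.le,
    Real.enorm_abs]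

lemma integrable_avgCondCovDev (n : ℕ) (j k : Fin m) :
    Integrable (fun ω => avgCondCovDev P μ x β₀ y n ω j k) P := by
  simp only [avgCondCovDev, Matrix.smul_apply, Matrix.sum_apply, smul_eq_mul, condCovDev,
    Matrix.of_apply]
  exact (integrable_finsetSum _ fun i _ => integrable_condExp.sub (integrable_const _)).const_mul _

/-- Under (C1), the convergence in (C2) also holds in `L¹`. -/
lemma CondC2.tendsto_integral_abs (hC2 : CondC2 P μ x β₀ y) (hC1 : CondC1 P μ x β₀ y)
    (h : IsModel P μ x B β₀ y) (j k : Fin m) :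
    Tendsto (fun n => ∫ ω, |avgCondCovDev P μ x β₀ y n ω j k| ∂P) atTop (𝓝 0) := by
  obtain ⟨q, C, hq1, hq2, hmom⟩ := hC1.exists_moment h
  have hq0 : 0 < q := by linarith
  have hq' : (1 : ℝ≥0∞) ≤ ENNReal.ofReal q := by
    rw [← ENNReal.ofReal_one]
    exact ENNReal.ofReal_le_ofReal hq1.le
  have hqne : ENNReal.ofReal q ≠ 0 := by simpa using hq0
  rw [← tendsto_eLpNorm_one_iff fun n => integrable_avgCondCovDev n j k]
  set z : ℕ → Ω → ℝ := fun i ω => ystar μ x β₀ y i ω j * ystar μ x β₀ y i ω k with hz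
  set D := C ^ (1 / q) with hD
  have hC0 : 0 ≤ C := (integral_nonneg fun ω => by positivity).trans (hmom 0 j k).2
  have hzD : ∀ i, eLpNorm (z i) (ENNReal.ofReal q) P ≤ ENNReal.ofReal D := by
    intro i
    rw [(hmom i j k).1.eLpNorm_eq_integral_rpow_norm hqne ENNReal.ofReal_ne_top,
      ENNReal.toReal_ofReal hq0.le, hD, one_div]
    refine ENNReal.ofReal_le_ofReal (Real.rpow_le_rpow (integral_nonneg fun ω => by positivity)
      ?_ (by positivity))
    exact (hmom i j k).2
  -- Conditional expectation contracts `L^q`, and the true correlation is an expectation of the same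
  -- product, so each deviation costs at most `2D`; averages inherit the bound, which supplies
  -- uniform integrability.
  have hterm : ∀ i, eLpNorm (fun ω => condCovDev P μ x β₀ y i ω j k) (ENNReal.ofReal q) P ≤
      ENNReal.ofReal (2 * D) := by
    intro i
    have h1 : eLpNorm (P[z i | past μ x β₀ y i]) (ENNReal.ofReal q) P ≤ ENNReal.ofReal D :=
      (eLpNorm_condExp_le_eLpNorm _ hq').trans (hzD i)
    have h2 : eLpNorm (fun _ : Ω => trueCorr P y i j k) (ENNReal.ofReal q) P ≤
        ENNReal.ofReal D := by
      rw [eLpNorm_const _ hqne (IsProbabilityMeasure.ne_zero P), measure_univ, ENNReal.one_rpow,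
        mul_one, ← h.integral_ystar_mul]
      refine (enorm_integral_le_lintegral_enorm _).trans ?_
      rw [← eLpNorm_one_eq_lintegral_enorm]
      exact (eLpNorm_le_eLpNorm_of_exponent_le hq' (hmom i j k).1.1).trans (hzD i)
    have h3 := eLpNorm_sub_le (μ := P) (f := P[z i | past μ x β₀ y i])
      (g := fun _ : Ω => trueCorr P y i j k) integrable_condExp.aestronglyMeasurable
      aestronglyMeasurable_const hq'
    refine h3.trans ((add_le_add h1 h2).trans ?_)
    rw [← ENNReal.ofReal_add (by positivity) (by positivity), two_mul]
  refine tendsto_eLpNorm_one_of_tendstoInMeasure (C := 2 * D) hq1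
    (fun n => (integrable_avgCondCovDev n j k).aestronglyMeasurable) (fun n => ?_) (hC2 j k)
  have hsum : (fun ω => avgCondCovDev P μ x β₀ y n ω j k) =
      (n : ℝ)⁻¹ • ∑ i ∈ Finset.range n, fun ω => condCovDev P μ x β₀ y i ω j k := by
    ext ω
    simp [avgCondCovDev, Matrix.sum_apply]
  rw [hsum, eLpNorm_const_smul]
  have hle : eLpNorm (∑ i ∈ Finset.range n, fun ω => condCovDev P μ x β₀ y i ω j k)
      (ENNReal.ofReal q) P ≤ n * ENNReal.ofReal (2 * D) := by
    refine (eLpNorm_sum_le (fun i _ => ?_) hq').trans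
      ((Finset.sum_le_sum fun i _ => hterm i).trans (by simp))
    exact (integrable_condExp.sub (integrable_const _)).aestronglyMeasurable
  calc ‖(n : ℝ)⁻¹‖ₑ * eLpNorm (∑ i ∈ Finset.range n, fun ω => condCovDev P μ x β₀ y i ω j k)
        (ENNReal.ofReal q) P ≤ ‖(n : ℝ)⁻¹‖ₑ * (n * ENNReal.ofReal (2 * D)) := by gcongr
    _ = ENNReal.ofReal ((n : ℝ)⁻¹ * n * (2 * D)) := by
        rw [Real.enorm_eq_ofReal (by positivity), ← ENNReal.ofReal_natCast n,
          ← ENNReal.ofReal_mul (by positivity), ← ENNReal.ofReal_mul (by positivity), mul_assoc]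
    _ ≤ ENNReal.ofReal (2 * D) := by
        refine ENNReal.ofReal_le_ofReal (mul_le_of_le_one_left (by positivity) inv_mul_le_one)

/-- If `f n - c n → 0` in `L¹`, then the expectations satisfy `E (f n) - c n → 0`. -/
lemma tendsto_integral_sub_const {f : ℕ → Ω → ℝ} {c : ℕ → ℝ} (hf : ∀ n, Integrable (f n) P)
    (h : Tendsto (fun n => ∫ ω, |f n ω - c n| ∂P) atTop (𝓝 0)) :
    Tendsto (fun n => ∫ ω, f n ω ∂P - c n) atTop (𝓝 0) := by
  refine squeeze_zero_norm (fun n => ?_) h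
  have h1 : ∫ ω, f n ω ∂P - c n = ∫ ω, (f n ω - c n) ∂P := by
    rw [integral_sub (hf n) (integrable_const _)]
    simp
  rw [h1]
  exact norm_integral_le_integral_norm _

/-- Estimators that stay in ellipsoids on which the standardization is asymptotically that at the
true parameter give consistent estimators of the average correlation matrix. -/
lemma corrConsistent_of_abs_sub_le {βt : ℕ → Ω → EuclideanSpace ℝ (Fin p)}
    (h : IsModel P μ x B β₀ y) (hC1 : CondC1 P μ x β₀ y) (hC2 : CondC2 P μ x β₀ y)
    (hmeas : ∀ n, Measurable (βt n))
    (hbdd : ∀ n, ∃ c, ∀ ω, quadIndep μ x β₀ n (βt n ω - β₀) ≤ c)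
    (hcomp : ∀ ε : ℝ, 0 < ε → ∀ᶠ n : ℕ in atTop, ∀ ω j k, |estCorr μ x y βt n ω j k - (n : ℝ)⁻¹ *
        ∑ i ∈ Finset.range n, ystar μ x β₀ y i ω j * ystar μ x β₀ y i ω k| ≤
          ε * (1 + avgSqNorm μ x β₀ y n ω)) :
    CorrConsistent P μ x β₀ y βt := by
  obtain ⟨q, C, hq1, hq2, hmom⟩ := hC1.exists_moment h
  have hq0 : 0 < q := by linarith
  have hqne : ENNReal.ofReal q ≠ 0 := by simpa using hq0
  have hpos := h.link_deriv_pos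
  have hθm : ∀ n i j, Measurable fun ω => theta x i j (βt n ω) := by
    intro n i j
    have hcont : Continuous fun β : EuclideanSpace ℝ (Fin p) => theta x i j β := by
      unfold theta dotProduct
      fun_prop
    exact hcont.measurable.comp (hmeas n)
  -- For each fixed `n` the ellipsoid bound makes the random standardization bounded, so the
  -- responses dominate; this gives integrability at every `n`, not only eventually.
  have hstd : ∀ n, ∀ i < n, ∀ j, MemLp (fun ω =>
      (√(sigmaSq μ x i j (βt n ω)))⁻¹ * resid μ x y i (βt n ω) ω j) 2 P := by
    intro n i hi j
    obtain ⟨c, hc⟩ := hbdd n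
    obtain ⟨K, hK⟩ := exists_bound_of_quadIndep_le hpos h.link_contDiff hi j c
      (x := x) (β₀ := β₀)
    have hK' := fun ω => hK (βt n ω) (hc ω)
    have hyj : Measurable fun ω => y i ω j := (measurable_pi_apply j).comp (h.measurable_obs i)
    have hm : Measurable fun ω =>
        (√(sigmaSq μ x i j (βt n ω)))⁻¹ * resid μ x y i (βt n ω) ω j := by
      refine Measurable.mul ?_ (hyj.sub (h.link_contDiff.continuous.measurable.comp (hθm n i j)))
      exact (Real.continuous_sqrt.measurable.comp
        (h.link_contDiff.continuous_deriv_one.measurable.comp (hθm n i j))).inv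
    have hdom : MemLp (fun ω => K * (|y i ω j| + K)) 2 P :=
      ((h.sq_integrable i j).abs.add (memLp_const K)).const_mul K
    refine hdom.mono hm.aestronglyMeasurable (Eventually.of_forall fun ω => ?_)
    have hK0 : 0 ≤ K := (abs_nonneg _).trans (hK' ω).1
    rw [norm_mul, Real.norm_eq_abs, Real.norm_eq_abs, Real.norm_of_nonneg (by positivity)]
    refine mul_le_mul (hK' ω).1 ?_ (abs_nonneg _) hK0
    exact (abs_sub _ _).trans (by gcongr; exact (hK' ω).2)
  have hint : ∀ n j k, Integrable (fun ω => estCorr μ x y βt n ω j k) P := by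
    intro n j k
    simp only [estCorr_apply]
    refine (integrable_finsetSum _ fun i hi => ?_).const_mul _
    exact (hstd n i (Finset.mem_range.1 hi) j).integrable_mul (hstd n i (Finset.mem_range.1 hi) k)
  set z : Fin m → Fin m → ℕ → Ω → ℝ := fun j k i ω =>
    ystar μ x β₀ y i ω j * ystar μ x β₀ y i ω k with hz
  have hzint : ∀ j k i, Integrable (z j k i) P := fun j k i => h.integrable_ystar_mul i j k
  have hzq : ∀ j k i, Integrable (fun ω => |z j k i ω| ^ q) P := by
    intro j k i
    have := (hmom i j k).1.integrable_norm_rpow hqne ENNReal.ofReal_ne_top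
    simpa only [ENNReal.toReal_ofReal hq0.le, Real.norm_eq_abs] using this
  have hzm : ∀ j k i, StronglyMeasurable[h.filtration (i + 1)] (z j k i) := fun j k i =>
    ((h.measurable_ystar_filtration i j).mul
      (h.measurable_ystar_filtration i k)).stronglyMeasurable
  -- The three errors: change of parameter, martingale average, and the (C2) average.
  set F₁ : Fin m → Fin m → ℕ → Ω → ℝ := fun j k n ω => estCorr μ x y βt n ω j k - (n : ℝ)⁻¹ *
    ∑ i ∈ Finset.range n, z j k i ω with hF₁
  set F₂ : Fin m → Fin m → ℕ → Ω → ℝ := fun j k n ω => (n : ℝ)⁻¹ *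
    ∑ i ∈ Finset.range n, (z j k i ω - (P[z j k i | h.filtration i]) ω) with hF₂
  set F₃ : Fin m → Fin m → ℕ → Ω → ℝ := fun j k n ω => avgCondCovDev P μ x β₀ y n ω j k with hF₃
  have hhat : ∀ j k (n : ℕ) ω, (n : ℝ)⁻¹ * ∑ i ∈ Finset.range n, z j k i ω - avgTrueCorr P y n j k =
      F₂ j k n ω + F₃ j k n ω := fun j k n ω => by
    rw [sub_eq_iff_eq_add]
    exact average_ystar_mul_eq n ω j k
  have hsplit : ∀ j k n ω, estCorr μ x y βt n ω j k - avgTrueCorr P y n j k =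
      F₁ j k n ω + (F₂ j k n ω + F₃ j k n ω) := fun j k n ω => by
    rw [← hhat, hF₁]
    ring
  have hF₁i : ∀ j k n, Integrable (F₁ j k n) P := fun j k n =>
    (hint n j k).sub ((integrable_finsetSum _ fun i _ => hzint j k i).const_mul _)
  have hF₂i : ∀ j k n, Integrable (F₂ j k n) P := fun j k n =>
    (integrable_finsetSum _ fun i _ => (hzint j k i).sub integrable_condExp).const_mul _
  have hF₃i : ∀ j k n, Integrable (F₃ j k n) P := fun j k n => integrable_avgCondCovDev n j k
  have hS0 : ∀ n ω, 0 ≤ avgSqNorm μ x β₀ y n ω := fun n ω => by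
    unfold avgSqNorm
    positivity
  have hF₁lim : ∀ j k, Tendsto (fun n => ∫ ω, |F₁ j k n ω| ∂P) atTop (𝓝 0) := by
    intro j k
    rw [Metric.tendsto_atTop']
    intro ε hε
    have hm1 : (0 : ℝ) < m + 2 := by positivity
    obtain ⟨N, hN⟩ := eventually_atTop.1 (hcomp (ε / (m + 2)) (by positivity))
    refine ⟨N, fun n hn => ?_⟩
    rw [dist_zero_right, Real.norm_of_nonneg (integral_nonneg fun ω => abs_nonneg _)]
    calc ∫ ω, |F₁ j k n ω| ∂P ≤ ∫ ω, ε / (m + 2) * (1 + avgSqNorm μ x β₀ y n ω) ∂P :=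
          integral_mono (hF₁i j k n).abs
            (((integrable_const _).add (h.integrable_avgSqNorm n)).const_mul _)
            fun ω => hN n hn.le ω j k
      _ = ε / (m + 2) * (1 + ∫ ω, avgSqNorm μ x β₀ y n ω ∂P) := by
          rw [integral_const_mul, integral_add (integrable_const _) (h.integrable_avgSqNorm n)]
          simp
      _ ≤ ε / (m + 2) * (1 + m) := by
          gcongr
          exact h.integral_avgSqNorm_le n
      _ < ε := by
          rw [div_mul_eq_mul_div, div_lt_iff₀ hm1]
          nlinarith
  have hF₂lim : ∀ j k, Tendsto (fun n => ∫ ω, |F₂ j k n ω| ∂P) atTop (𝓝 0) := fun j k =>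
    tendsto_integral_abs_average_martingaleDiff h.filtration (hzm j k) hq1 hq2 (hzint j k)
      (hzq j k) fun i => (hmom i j k).2
  have hF₃lim : ∀ j k, Tendsto (fun n => ∫ ω, |F₃ j k n ω| ∂P) atTop (𝓝 0) := fun j k =>
    hC2.tendsto_integral_abs hC1 h j k
  have hlim : ∀ j k, Tendsto
      (fun n => ∫ ω, |estCorr μ x y βt n ω j k - avgTrueCorr P y n j k| ∂P) atTop (𝓝 0) := by
    intro j k
    have hsum := (hF₁lim j k).add ((hF₂lim j k).add (hF₃lim j k))
    rw [add_zero, add_zero] at hsum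
    refine squeeze_zero (fun n => integral_nonneg fun ω => abs_nonneg _) (fun n => ?_) hsum
    have h23 : Integrable (fun ω => |F₂ j k n ω| + |F₃ j k n ω|) P :=
      (hF₂i j k n).abs.add (hF₃i j k n).abs
    rw [← integral_add (hF₂i j k n).abs (hF₃i j k n).abs, ← integral_add (hF₁i j k n).abs h23]
    refine integral_mono ((hint n j k).sub (integrable_const _)).abs
      ((hF₁i j k n).abs.add h23) fun ω => ?_
    dsimp only
    rw [hsplit]
    exact (abs_add_le _ _).trans (by gcongr; exact abs_add_le _ _)
  -- The two centrings differ by a deterministic null sequence, so each statement about `R_n`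
  -- follows from the one about the true average.
  have hmean : ∀ j k, Tendsto
      (fun n => meanEstCorr P μ x y βt n j k - avgTrueCorr P y n j k) atTop (𝓝 0) := fun j k =>
    tendsto_integral_sub_const (fun n => hint n j k) (hlim j k)
  have has : CondC2AS P μ x β₀ y → ElementwiseAS P (estCorr μ x y βt) (avgTrueCorr P y) := by
    intro hAS j k
    -- All entries are needed on one event: bounding `F₁` for a single entry uses the trace.
    have h23 : ∀ᵐ ω ∂P, ∀ j k, Tendsto (fun n => F₂ j k n ω + F₃ j k n ω) atTop (𝓝 0) := by
      rw [ae_all_iff]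
      intro j
      rw [ae_all_iff]
      intro k
      filter_upwards [hAS j k, ae_tendsto_average_martingaleDiff h.filtration (hzm j k) hq1 hq2
        (hzint j k) (hzq j k) fun i => (hmom i j k).2] with ω h3 h2
      simpa only [add_zero] using h2.add h3
    filter_upwards [h23] with ω hω
    have hdiag : Tendsto (fun n => ∑ j, (F₂ j j n ω + F₃ j j n ω)) atTop (𝓝 0) := by
      simpa using tendsto_finsetSum Finset.univ fun j _ => hω j j
    -- `avgSqNorm` is the trace of the empirical correlation matrix at `β₀`, and the true average
    -- has trace at most `m`.
    have hS : ∀ᶠ n in atTop, avgSqNorm μ x β₀ y n ω ≤ m + 1 := by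
      filter_upwards [hdiag.eventually_lt_const one_pos] with n hn
      have htr : avgSqNorm μ x β₀ y n ω - ∑ j, avgTrueCorr P y n j j =
          ∑ j, (F₂ j j n ω + F₃ j j n ω) := by
        rw [← Finset.sum_congr rfl fun j _ => hhat j j n ω, Finset.sum_sub_distrib, ← Finset.mul_sum, avgSqNorm, Finset.sum_comm]
        simp only [hz, sq]
      have hle : ∑ j, avgTrueCorr P y n j j ≤ m := by
        refine (Finset.sum_le_card_nsmul _ _ 1 fun j _ => ?_).trans (by simp)
        simp only [avgTrueCorr, Matrix.smul_apply, Matrix.sum_apply, h.trueCorr_self]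
        simpa using inv_mul_le_one (a := (n : ℝ))
      linarith
    have h1 : Tendsto (fun n => F₁ j k n ω) atTop (𝓝 0) := by
      rw [Metric.tendsto_nhds]
      intro ε hε
      have hm1 : (0 : ℝ) < m + 3 := by positivity
      filter_upwards [hS, hcomp (ε / (m + 3)) (by positivity)] with n hn hc
      rw [dist_zero_right, Real.norm_eq_abs]
      calc |F₁ j k n ω| ≤ ε / (m + 3) * (1 + avgSqNorm μ x β₀ y n ω) := hc ω j k
        _ ≤ ε / (m + 3) * (1 + (m + 1)) := by gcongr
        _ < ε := by
            rw [div_mul_eq_mul_div, div_lt_iff₀ hm1]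
            nlinarith
    simp only [hsplit]
    simpa using h1.add (hω j k)
  refine ⟨hint, fun j k => ?_, fun j k => ?_, fun hAS j k => ?_, has⟩
  · refine (tendsto_eLpNorm_one_iff fun n => (hint n j k).sub (integrable_const _)).2 ?_
    have hsum := (hlim j k).add ((hmean j k).abs)
    rw [abs_zero, add_zero] at hsum
    refine squeeze_zero (fun n => integral_nonneg fun ω => abs_nonneg _) (fun n => ?_) hsum
    set a := meanEstCorr P μ x y βt n j k - avgTrueCorr P y n j k with ha
    have hd : Integrable (fun ω => |estCorr μ x y βt n ω j k - avgTrueCorr P y n j k|) P :=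
      ((hint n j k).sub (integrable_const _)).abs
    calc ∫ ω, |estCorr μ x y βt n ω j k - meanEstCorr P μ x y βt n j k| ∂P
        ≤ ∫ ω, (|estCorr μ x y βt n ω j k - avgTrueCorr P y n j k| + |a|) ∂P := by
          refine integral_mono ((hint n j k).sub (integrable_const _)).abs
            (hd.add (integrable_const _)) fun ω => ?_
          dsimp only
          have : estCorr μ x y βt n ω j k - meanEstCorr P μ x y βt n j k =
              (estCorr μ x y βt n ω j k - avgTrueCorr P y n j k) - a := by
            rw [ha]
            ring
          rw [this]
          exact abs_sub _ _
      _ = _ := by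
          rw [integral_add hd (integrable_const _)]
          simp
  · exact (tendsto_eLpNorm_one_iff fun n => (hint n j k).sub (integrable_const _)).2 (hlim j k)
  · filter_upwards [has hAS j k] with ω hω
    simpa using hω.sub (hmean j k)

end Consistency

/-! ### Localized estimators and the diagonal choice of radii. -/

section Localization

variable {m p : ℕ} {Ω : Type*} {μ : ℝ → ℝ} {x : ℕ → Fin m → EuclideanSpace ℝ (Fin p)}
  {B : Set (EuclideanSpace ℝ (Fin p))} {β₀ : EuclideanSpace ℝ (Fin p)}
  {b : ℕ → Ω → EuclideanSpace ℝ (Fin p)}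

lemma localize_eq_of_mem {r : ℕ → ℝ} {n : ℕ} {ω : Ω}
    (h : b n ω ∈ ballIndep μ x B β₀ n (r n)) : localize μ x B β₀ b r n ω = b n ω :=
  if_pos h

lemma localize_eq_or (r : ℕ → ℝ) (n : ℕ) (ω : Ω) :
    localize μ x B β₀ b r n ω = b n ω ∨ localize μ x B β₀ b r n ω = β₀ := by
  unfold localize
  split_ifs
  · exact Or.inl rfl
  · exact Or.inr rfl

lemma quadIndep_localize_le (hpos : ∀ t, 0 < deriv μ t) {r : ℕ → ℝ} (hr : ∀ n, 0 ≤ r n) (n : ℕ)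
    (ω : Ω) :
    quadIndep μ x β₀ n (localize μ x B β₀ b r n ω - β₀) ≤ m * r n ^ 2 := by
  unfold localize
  split_ifs with h
  · exact ((mem_ballIndep_iff hpos (hr n)).1 h).2
  · have h0 : quadIndep μ x β₀ n (β₀ - β₀) = 0 := by simp [quadIndep]
    rw [h0]
    positivity

lemma measurableSet_ballIndep (hpos : ∀ t, 0 < deriv μ t) (hB : IsOpen B) {n : ℕ} {r : ℝ}
    (hr : 0 ≤ r) : MeasurableSet (ballIndep μ x B β₀ n r) := by
  have hcont : Continuous fun β => quadIndep μ x β₀ n (β - β₀) := by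
    unfold quadIndep dotProduct
    fun_prop
  have : ballIndep μ x B β₀ n r = B ∩ {β | quadIndep μ x β₀ n (β - β₀) ≤ m * r ^ 2} := by
    ext β
    exact mem_ballIndep_iff hpos hr
  rw [this]
  exact hB.measurableSet.inter (isClosed_le hcont continuous_const).measurableSet

lemma measurable_localize [MeasurableSpace Ω] (hpos : ∀ t, 0 < deriv μ t) (hB : IsOpen B)
    (hb : ∀ n, Measurable (b n)) {r : ℕ → ℝ} (hr : ∀ n, 0 ≤ r n) (n : ℕ) :
    Measurable (localize μ x B β₀ b r n) := by
  classical
  exact Measurable.ite (hb n (measurableSet_ballIndep hpos hB (hr n))) (hb n) measurable_const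

/-- Diagonal selection of slowly increasing indices. -/
lemma exists_tendsto_atTop_eventually {Q : ℕ → ℕ → Prop} (hQ : ∀ k, ∀ᶠ n in atTop, Q k n) :
    ∃ φ : ℕ → ℕ, Tendsto φ atTop atTop ∧ ∀ᶠ n in atTop, Q (φ n) n := by
  classical
  have hN : ∀ k, ∃ N, ∀ n ≥ N, Q k n := fun k => eventually_atTop.1 (hQ k)
  choose N hN using hN
  -- The largest `k ≤ n` whose threshold has been passed. `findGreatest` defaults to `0`, which is
  -- legitimate once `n ≥ N 0`.
  refine ⟨fun n => Nat.findGreatest (fun k => N k ≤ n) n, tendsto_atTop.2 fun k => ?_, ?_⟩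
  · filter_upwards [eventually_ge_atTop (max k (N k))] with n hn
    exact Nat.le_findGreatest ((le_max_left _ _).trans hn) ((le_max_right _ _).trans hn)
  · filter_upwards [eventually_ge_atTop (N 0)] with n hn
    exact hN _ n (Nat.findGreatest_spec (P := fun k => N k ≤ n) (Nat.zero_le n) hn)

/-- Radii tending to infinity eventually exceed the one that captures `b_n` with probability `1 -
ε`, so localization rarely changes `b_n`. Consistency is immediate, since moving to `β₀` only
reduces the distance to it. -/
lemma IsPrelim.localize [MeasurableSpace Ω] {P : Measure Ω} [IsProbabilityMeasure P]
    {y : ℕ → Ω → Fin m → ℝ} (hb : IsPrelim P μ x B β₀ y b) (h : IsModel P μ x B β₀ y)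
    (hC : CondIndep μ x B β₀) {ρ : ℕ → ℝ} (hρ0 : ∀ n, 0 ≤ ρ n) (hρ : Tendsto ρ atTop atTop) :
    IsPrelim P μ x B β₀ y (localize μ x B β₀ b ρ) := by
  have hpos := h.link_deriv_pos
  refine ⟨measurable_localize hpos h.isOpen_param hb.measurable hρ0, fun n ω => ?_, ?_, ?_⟩
  · rcases localize_eq_or (μ := μ) (x := x) (B := B) (β₀ := β₀) (b := b) ρ n ω with h1 | h1 <;>
      rw [h1]
    · exact hb.mem n ω
    · exact h.true_mem
  · have hreal : Tendsto (fun n => P.real {ω | gIndep μ x y n (b n ω) ω = 0}) atTop (𝓝 1) := by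
      have := (ENNReal.tendsto_toReal ENNReal.one_ne_top).comp hb.root
      rwa [ENNReal.toReal_one] at this
    have key : Tendsto (fun n => P.real
        {ω | gIndep μ x y n (LongitudinalGEE.localize μ x B β₀ b ρ n ω) ω = 0}) atTop (𝓝 1) := by
      refine tendsto_order.2 ⟨fun a ha => ?_, fun a ha =>
        Eventually.of_forall fun n => measureReal_le_one.trans_lt ha⟩
      -- Two exceptional events, no root and outside the ball, share the allowance `1 - a`.
      set ε := (1 - a) / 2 with hε
      have hε0 : 0 < ε := by linarith
      obtain ⟨r, hr, N, hN⟩ := hb.exists_radius h hC hε0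
      filter_upwards [eventually_ge_atTop N, hρ.eventually_ge_atTop r,
        hreal.eventually_const_lt (by linarith : 1 - ε < 1)] with n hn hrn hroot
      have hball : 1 - ε ≤ P.real {ω | b n ω ∈ ballIndep μ x B β₀ n (ρ n)} := by
        refine (hN n hn).trans (measureReal_mono fun ω hω => ?_)
        rw [Set.mem_ofPred_eq, mem_ballIndep_iff hpos (hρ0 n)]
        have h1 := (mem_ballIndep_iff hpos hr.le).1 hω
        exact ⟨h1.1, h1.2.trans (by gcongr)⟩
      have hcover : {ω | gIndep μ x y n (b n ω) ω = 0} ⊆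
          {ω | gIndep μ x y n (LongitudinalGEE.localize μ x B β₀ b ρ n ω) ω = 0} ∪
            {ω | b n ω ∈ ballIndep μ x B β₀ n (ρ n)}ᶜ := by
        intro ω hω
        by_cases hin : b n ω ∈ ballIndep μ x B β₀ n (ρ n)
        · left
          rw [Set.mem_ofPred_eq, localize_eq_of_mem hin]
          exact hω
        · exact Or.inr hin
      have h1 := (measureReal_mono (μ := P) hcover).trans (measureReal_union_le _ _)
      have hcompl := probReal_compl_eq_one_sub (μ := P)
        (hb.measurable n (measurableSet_ballIndep (x := x) (β₀ := β₀) (n := n) hpos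
          h.isOpen_param (hρ0 n)))
      have h2 : a = 1 - ε - ε := by
        rw [hε]
        ring
      change P.real {ω | b n ω ∈ ballIndep μ x B β₀ n (ρ n)}ᶜ =
        1 - P.real {ω | b n ω ∈ ballIndep μ x B β₀ n (ρ n)} at hcompl
      linarith
    have := ENNReal.tendsto_ofReal key
    simpa [measureReal_def] using this
  · intro ε hε
    refine tendsto_of_tendsto_of_tendsto_of_le_of_le tendsto_const_nhds (hb.consistent ε hε)
      (fun n => zero_le) fun n => measure_mono fun ω hω => ?_
    refine le_trans (α := ℝ≥0∞) hω ?_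
    rcases localize_eq_or (μ := μ) (x := x) (B := B) (β₀ := β₀) (b := b) ρ n ω with h1 | h1 <;>
      rw [h1]
    rw [edist_self]
    exact zero_le

end Localization

end LongitudinalGEE

/-! ### Assembly of the three assertions. -/

theorem theorem1 {m p : ℕ} {Ω : Type*} [MeasurableSpace Ω] (P : Measure Ω)
    [IsProbabilityMeasure P] (μ : ℝ → ℝ) (x : ℕ → Fin m → EuclideanSpace ℝ (Fin p))
    (B : Set (EuclideanSpace ℝ (Fin p))) (β₀ : EuclideanSpace ℝ (Fin p))
    (y : ℕ → Ω → Fin m → ℝ) (b : ℕ → Ω → EuclideanSpace ℝ (Fin p))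
    (hmodel : LongitudinalGEE.IsModel P μ x B β₀ y)
    (hC : LongitudinalGEE.CondIndep μ x B β₀)
    (hC1 : LongitudinalGEE.CondC1 P μ x β₀ y)
    (hC2 : LongitudinalGEE.CondC2 P μ x β₀ y)
    (hb : LongitudinalGEE.IsPrelim P μ x B β₀ y b) :
    (∀ ε : ℝ, 0 < ε → ∃ r : ℝ, 0 < r ∧ ∃ N : ℕ, ∀ n ≥ N,
      1 - ε ≤ P.real {ω | b n ω ∈ LongitudinalGEE.ballIndep μ x B β₀ n r}) ∧
    (∀ r : ℝ, 0 < r → LongitudinalGEE.CorrConsistent P μ x β₀ y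
      (LongitudinalGEE.localize μ x B β₀ b (fun _ => r))) ∧
    (∃ ρ : ℕ → ℝ, Tendsto ρ atTop atTop ∧
      LongitudinalGEE.IsPrelim P μ x B β₀ y (LongitudinalGEE.localize μ x B β₀ b ρ) ∧
      LongitudinalGEE.CorrConsistent P μ x β₀ y
        (LongitudinalGEE.localize μ x B β₀ b ρ)) := by
  have hpos := hmodel.link_deriv_pos
  have hunif := fun {r ε : ℝ} (hr : 0 < r) (hε : 0 < ε) =>
    hC.eventually_abs_estCorr_sub_le y hpos hmodel.differentiable_link hmodel.isOpen_param
      hmodel.true_mem hr hε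
  refine ⟨fun ε hε => hb.exists_radius hmodel hC hε, fun r hr => ?_, ?_⟩
  · have hquad := LongitudinalGEE.quadIndep_localize_le (x := x) (B := B) (β₀ := β₀) (b := b) hpos
      (r := fun _ => r) fun _ => hr.le
    refine LongitudinalGEE.corrConsistent_of_abs_sub_le hmodel hC1 hC2
      (LongitudinalGEE.measurable_localize hpos hmodel.isOpen_param hb.measurable fun _ => hr.le)
      (fun n => ⟨_, hquad n⟩) fun ε hε => ?_
    filter_upwards [hunif hr hε] with n hn ω
    exact hn _ ω (hquad n ω)
  -- Stage `k` asks for radius `k + 1` and tolerance `1/(k + 1)`; along the diagonal the radius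
  -- grows while the tolerance vanishes. The comparison is uniform over estimators, so it applies to
  -- the one localized at the radii just chosen.
  · obtain ⟨φ, hφ, hφQ⟩ := LongitudinalGEE.exists_tendsto_atTop_eventually fun k : ℕ =>
      hunif (r := (k : ℝ) + 1) (ε := 1 / ((k : ℝ) + 1)) (by positivity) (by positivity)
    have hρ0 : ∀ n, (0 : ℝ) ≤ (φ n : ℝ) + 1 := fun n => by positivity
    have hρ : Tendsto (fun n => (φ n : ℝ) + 1) atTop atTop :=
      tendsto_atTop_add_const_right _ _ (tendsto_natCast_atTop_atTop.comp hφ)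
    have hquad := LongitudinalGEE.quadIndep_localize_le (x := x) (B := B) (β₀ := β₀) (b := b) hpos
      (r := fun n => (φ n : ℝ) + 1) hρ0
    refine ⟨fun n => (φ n : ℝ) + 1, hρ, hb.localize hmodel hC hρ0 hρ,
      LongitudinalGEE.corrConsistent_of_abs_sub_le hmodel hC1 hC2
      (LongitudinalGEE.measurable_localize hpos hmodel.isOpen_param hb.measurable hρ0)
      (fun n => ⟨_, hquad n⟩) fun ε hε => ?_⟩
    have hsmall : Tendsto (fun n => 1 / ((φ n : ℝ) + 1)) atTop (𝓝 0) :=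
      (tendsto_one_div_add_atTop_nhds_zero_nat (𝕜 := ℝ)).comp hφ
    filter_upwards [hφQ, hsmall.eventually_le_const hε] with n hn hle ω j k
    refine (hn _ ω (hquad n ω) j k).trans (mul_le_mul_of_nonneg_right hle ?_)
    unfold LongitudinalGEE.avgSqNorm
    positivity
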